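/- Let $K$ be a field, $\theta$ an automorphism of $K$ of finite order $r$, and $F=\{a\in K:\theta(a)=a\}$. Assume that the characteristic of $K$ does not divide $r$. Let $\mathcal A=K[X^{\pm1};\theta]$ be the ring of skew Laurent polynomials ($Xa=\theta(a)X$ for $a\in K$), put $Y=X^r$, and let $\mathcal Z=F[Y^{\pm1}]$, which is the centre of $\mathcal A$; let $\mathrm{Frac}(\mathcal Z)=F(Y)$ and $\mathrm{Frac}(\mathcal A)=\mathrm{Frac}(\mathcal Z)\otimes_{\mathcal Z}\mathcal A$. Let $F^{\mathrm s}$ be a separable closure of $F$. For $z\in F^{\mathrm s}$ with $z\neq0$, let $N_z\in F[Y]$ be its minimal polynomial; identify $\mathcal Z/N_z\mathcal Z$ with $F(z)$ by $Y\mapsto z$. The canonical Taylor expansion at $z$ is the ring homomorphism $$\mathrm{TS}_{z,\mathrm{can}}:\mathrm{Frac}(\mathcal A)\to(\mathcal A/N_z\mathcal A)((T)),\qquad a\mapsto a\ (a\in K),\qquad X\mapsto\Big(1+\frac Tz\Big)^{1/r}X,$$ where $T$ is a central variable and $(1+T/z)^{1/r}$ is the $r$-th root with constant term $1$ (so that $Y\mapsto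 z+T$). The canonical skew residue $\mathrm{sres}_{z,\mathrm{can}}(f)\in\mathcal A/N_z\mathcal A$ is the coefficient of $T^{-1}$ in $\mathrm{TS}_{z,\mathrm{can}}(f)$. Theorem. Let $\gamma:\mathrm{Frac}(\mathcal A)\to\mathrm{Frac}(\mathcal A)$ be an endomorphism of $K$-algebras, that is, a ring endomorphism which is the identity on $K$, and assume that $\gamma(X)X^{-1}\in\mathrm{Frac}(\mathcal Z)$. Then $\gamma(Y)\in\mathrm{Frac}(\mathcal Z)=F(Y)$. Let $z\in F^{\mathrm s}$, $z\neq0$, be $\gamma$-regular, that is, such that the rational function $\gamma(Y)$ has neither a zero nor a pole at $Y=z$ and $\frac{d\gamma(Y)}{dY}$ does not vanish at $Y=z$. Let $\gamma_\star z\in F^{\mathrm s}\setminus\{0\}$ be the value of $\gamma(Y)$ at $Y=z$. Then reduction of $\gamma$ modulo $N_z$ induces a unique ring homomorphism $\mathcal A/N_{\gamma_\star z}\mathcal A\to\mathcal A/N_z\mathcal A$, still denoted by $\gamma$, and for every $f\in\mathrm{Frac}(\mathcal A)$, $$\gamma\big(\mathrm{sres}_{\gamma_\star z,\mathrm{can}}(f)\big)=\mathrm{sres}_{z,\mathrm{can}}\Big(\gamma(f)\cdot\frac{d\gamma(Y)}{dY}\Big)\quad\text{in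 }\mathcal A/N_z\mathcal A.$$ -/

import Mathlib

open scoped TensorProduct

noncomputable section

namespace SkewRes

/-! ### Two general facts on Laurent series -/

/-- Coefficientwise application of a ring homomorphism to Laurent series (over possibly
noncommutative rings). -/
def laurentMap {R S : Type*} [Ring R] [Ring S] (f : R →+* S) :
    LaurentSeries R →+* LaurentSeries S where
  toFun x := HahnSeries.map x f
  map_one' := by ext n; by_cases h : n = 0 <;> simp [h, HahnSeries.coeff_one]
  map_zero' := by ext n; simp
  map_add' x y := by ext n; simp
  map_mul' x y := HahnSeries.map_mul (f : R →ₙ+* S)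

theorem laurentMap_single {R S : Type*} [Ring R] [Ring S] (f : R →+* S) (n : ℤ) (a : R) :
    laurentMap f (HahnSeries.single n a) = HahnSeries.single n (f a) := by
  ext m
  change f ((HahnSeries.single n a).coeff m) = _
  by_cases h : m = n <;> simp [h]

theorem commute_laurent {R : Type*} [Ring R] (x y : LaurentSeries R)
    (h : ∀ m n, Commute (x.coeff m) (y.coeff n)) : Commute x y := by
  change x * y = y * x
  ext a
  rw [HahnSeries.coeff_mul, HahnSeries.coeff_mul]
  refine Finset.sum_nbij' Prod.swap Prod.swap ?_ ?_ ?_ ?_ ?_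
  · rintro ⟨i, j⟩ hij
    simp only [Finset.mem_antidiagonal, Prod.swap] at hij ⊢
    exact ⟨hij.2.1, hij.1, by rw [add_comm]; exact hij.2.2⟩
  · rintro ⟨i, j⟩ hij
    simp only [Finset.mem_antidiagonal, Prod.swap] at hij ⊢
    exact ⟨hij.2.1, hij.1, by rw [add_comm]; exact hij.2.2⟩
  · intro _ _; rfl
  · intro _ _; rfl
  · rintro ⟨i, j⟩ _
    exact h i j

/-- If `r` is invertible in the field `F`, then `1 + T` has an `r`-th root in `F[[T]]` with
constant term `1`. -/
theorem exists_root_one_add {F : Type*} [Field F] (r : ℕ) (hr : (r : F) ≠ 0) :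
    ∃ G : PowerSeries F, PowerSeries.constantCoeff G = 1 ∧ G ^ r = 1 + PowerSeries.X := by
  have hr0 : r ≠ 0 := by rintro rfl; simp at hr
  let I : Ideal (PowerSeries F) := Ideal.span {PowerSeries.X}
  let P : Polynomial (PowerSeries F) := Polynomial.X ^ r - Polynomial.C (1 + PowerSeries.X)
  have hP : P.Monic := Polynomial.monic_X_pow_sub_C _ hr0
  have h1 : P.eval 1 ∈ I := by
    have : P.eval 1 = - PowerSeries.X := by simp [P]
    rw [this]
    exact I.neg_mem (Ideal.subset_span rfl)
  have h2 : IsUnit (Ideal.Quotient.mk I (P.derivative.eval 1)) := by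
    have : P.derivative.eval 1 = (r : PowerSeries F) := by
      simp [P, Polynomial.derivative_X_pow]
    rw [this]
    refine IsUnit.map _ ?_
    rw [PowerSeries.isUnit_iff_constantCoeff]
    simpa using hr
  obtain ⟨G, hG, hG1⟩ := HenselianRing.is_henselian P hP 1 h1 h2
  refine ⟨G, ?_, ?_⟩
  · have := Ideal.mem_span_singleton.1 hG1
    rw [PowerSeries.X_dvd_iff] at this
    simpa [sub_eq_zero] using this
  · have : G ^ r - (1 + PowerSeries.X) = 0 := by simpa [P, Polynomial.IsRoot] using hG
    exact sub_eq_zero.1 this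

/-- The power series `(1 + T)^{1/r} = ∑ (1/n!) (1/r) (1/r - 1) ⋯ (1/r - (n - 1)) T^n`, that is, the
`r`-th root of `1 + T` with constant term `1` (unique, as `r` is invertible). -/
def rootSeries {F : Type*} [Field F] (r : ℕ) (hr : (r : F) ≠ 0) : PowerSeries F :=
  (exists_root_one_add r hr).choose

theorem constantCoeff_rootSeries {F : Type*} [Field F] (r : ℕ) (hr : (r : F) ≠ 0) :
    PowerSeries.constantCoeff (rootSeries r hr) = 1 :=
  (exists_root_one_add r hr).choose_spec.1

theorem rootSeries_pow {F : Type*} [Field F] (r : ℕ) (hr : (r : F) ≠ 0) :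
    rootSeries r hr ^ r = 1 + PowerSeries.X :=
  (exists_root_one_add r hr).choose_spec.2

variable {K : Type*} [Field K] (θ : RingAut K)

/-! ### The base field, the skew Laurent polynomials and the centre -/

/-- The fixed field `F` of `θ`. -/
abbrev FixedField : Subfield K := (RingEquiv.toRingHom θ).eqLocusField (RingHom.id K)

/-- If the characteristic does not divide the order of `θ` (in particular, the order is finite, as
`orderOf θ = 0` otherwise), then this order is invertible in the fixed field. -/
theorem order_ne_zero {θ : RingAut K} (hp : ¬ ringChar K ∣ orderOf θ) :
    ((orderOf θ : ℕ) : FixedField θ) ≠ 0 := by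
  intro h
  apply hp
  rw [← ringChar.spec]
  have := congrArg (fun x : FixedField θ => (x : K)) h
  simpa using this

/-- The commutative Laurent polynomial ring `F[Y^{±1}]`. -/
abbrev Centre := LaurentPolynomial (FixedField θ)

/-- The action of `ℤ` on `K` by the powers of `θ`. -/
abbrev zAction : MulSemiringAction (Multiplicative ℤ) K :=
  MulSemiringAction.compHom K (zpowersHom (RingAut K) θ)

/-- The skew Laurent polynomial ring `A = K[X^{±1}; θ]`: finite sums `∑ a_i X^i`, `i ∈ ℤ`, with
`X^i a = θ^i(a) X^i`. -/
def Skew (_θ : RingAut K) : Type _ := SkewMonoidAlgebra K (Multiplicative ℤ)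

instance : Ring (Skew θ) :=
  letI := zAction θ
  inferInstanceAs (Ring (SkewMonoidAlgebra K (Multiplicative ℤ)))

/-- The monomial `a X^n`. -/
def mono (a : K) (n : ℤ) : Skew θ := SkewMonoidAlgebra.single (Multiplicative.ofAdd n) a

theorem mono_mul_mono (a b : K) (m n : ℤ) :
    mono θ a m * mono θ b n = mono θ (a * (θ ^ m) b) (m + n) := by
  let := zAction θ
  exact SkewMonoidAlgebra.single_mul_single (k := K) (G := Multiplicative ℤ)

theorem mono_zero_one : mono θ 1 0 = 1 := rfl

theorem mono_add (a b : K) (n : ℤ) : mono θ (a + b) n = mono θ a n + mono θ b n :=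
  SkewMonoidAlgebra.single_add _ _ _

theorem mono_zero (n : ℤ) : mono θ 0 n = 0 := SkewMonoidAlgebra.single_zero _

theorem skew_induction {P : Skew θ → Prop} (h0 : P 0) (h1 : ∀ a n, P (mono θ a n))
    (h2 : ∀ x y, P x → P y → P (x + y)) (x : Skew θ) : P x :=
  SkewMonoidAlgebra.induction_on (k := K) (G := Multiplicative ℤ) (p := P) x h0
    (fun g a => h1 a g.toAdd) (fun {x y} => h2 x y)

/-- The inclusion of `K` in `A`. -/
def ofK : K →+* Skew θ where
  toFun a := mono θ a 0
  map_one' := rfl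
  map_zero' := mono_zero θ 0
  map_add' a b := mono_add θ a b 0
  map_mul' a b := by simp [mono_mul_mono]

/-- The variable `X`, as a unit of `A`. -/
def X : (Skew θ)ˣ where
  val := mono θ 1 1
  inv := mono θ 1 (-1)
  val_inv := by simp [mono_mul_mono, mono_zero_one]
  inv_val := by simp [mono_mul_mono, mono_zero_one]

theorem X_zpow (n : ℤ) : ((X θ ^ n : (Skew θ)ˣ) : Skew θ) = mono θ 1 n := by
  induction n using Int.induction_on with
  | zero => rfl
  | succ i ih =>
    rw [zpow_add_one, Units.val_mul, ih]
    change mono θ 1 _ * mono θ 1 1 = _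
    simp [mono_mul_mono]
  | pred i ih =>
    rw [zpow_sub_one, Units.val_mul, ih]
    change mono θ 1 _ * mono θ 1 (-1) = _
    simp [mono_mul_mono, sub_eq_add_neg]

theorem fixed_zpow (a : FixedField θ) (n : ℤ) : (θ ^ n) (a : K) = a := by
  have h : θ (a : K) = a := a.2
  have h' : (θ⁻¹) (a : K) = a := by
    conv_lhs => rw [← h]
    exact RingEquiv.symm_apply_apply θ _
  induction n using Int.induction_on with
  | zero => rfl
  | succ i ih => rw [zpow_add_one]; change (θ ^ (i : ℤ)) (θ a) = a; rw [h, ih]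
  | pred i ih => rw [zpow_sub_one]; change (θ ^ (-(i : ℤ))) (θ⁻¹ a) = a; rw [h', ih]

theorem zpow_order_mul (b : K) (n : ℤ) : (θ ^ ((orderOf θ : ℤ) * n)) b = b := by
  rw [zpow_mul, zpow_natCast, pow_orderOf_eq_one, one_zpow]
  rfl

theorem fixed_commute (a : FixedField θ) (n : ℤ) (b : K) (m : ℤ) :
    Commute (mono θ a ((orderOf θ : ℤ) * n)) (mono θ b m) := by
  change _ * _ = _ * _
  rw [mono_mul_mono, mono_mul_mono, zpow_order_mul, fixed_zpow, mul_comm, add_comm]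

/-- The embedding `F[Y^{±1}] → A`, `∑ a_n Y^n ↦ ∑ a_n X^{rn}`, with `r` the order of `θ`. -/
def centreHom : Centre θ →+* Skew θ :=
  AddMonoidAlgebra.liftNCRingHom ((ofK θ).comp (FixedField θ).subtype)
    ((Units.coeHom _).comp (zpowersHom _ (X θ ^ orderOf θ)))
    (by
      intro a n
      have h := (fixed_commute θ a 0 1 ((orderOf θ : ℤ) * n.toAdd))
      rw [mul_zero] at h
      change Commute (mono θ a 0) (((X θ ^ orderOf θ) ^ n.toAdd : (Skew θ)ˣ) : Skew θ)
      rw [← zpow_natCast, ← zpow_mul, X_zpow]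
      exact h)

theorem centreHom_single (n : ℤ) (a : FixedField θ) :
    centreHom θ (AddMonoidAlgebra.single n a) = mono θ a ((orderOf θ : ℤ) * n) := by
  rw [centreHom, AddMonoidAlgebra.liftNCRingHom_single]
  change mono θ a 0 * (((X θ ^ orderOf θ) ^ n : (Skew θ)ˣ) : Skew θ) = _
  rw [← zpow_natCast, ← zpow_mul, X_zpow, mono_mul_mono]
  simp

theorem centreHom_commute (c : Centre θ) (x : Skew θ) : Commute (centreHom θ c) x := by
  refine skew_induction θ (P := fun x => Commute (centreHom θ c) x) (Commute.zero_right _) ?_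
    (fun _ _ h h' => h.add_right h') x
  intro b m
  refine AddMonoidAlgebra.induction_linear
    (motive := fun c => Commute (centreHom θ c) (mono θ b m)) c ?_ ?_ ?_
  · rw [map_zero]; exact Commute.zero_left _
  · intro f g hf hg
    rw [map_add]; exact hf.add_left hg
  · intro n a
    rw [centreHom_single]
    exact fixed_commute θ a n b m

instance : Algebra (Centre θ) (Skew θ) :=
  (centreHom θ).toAlgebra' (fun c x => centreHom_commute θ c x)

/-! ### The skew field of fractions -/

/-- `F(Y)`, the fraction field of `F[Y^{±1}]`. -/
abbrev FracCentre := RatFunc (FixedField θ)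

instance : Algebra (Centre θ) (FracCentre θ) :=
  (LaurentPolynomial.eval₂ (RatFunc.C : FixedField θ →+* FracCentre θ)
    (Units.mk0 RatFunc.X RatFunc.X_ne_zero)).toAlgebra

/-- `Frac(A) = Frac(Z) ⊗_Z A`, where `Z = F[Y^{±1}]` is the centre of `A`. -/
abbrev FracSkew := FracCentre θ ⊗[Centre θ] Skew θ

/-- The inclusion of `A` in `Frac(A)`. -/
def ofSkew : Skew θ →+* FracSkew θ :=
  (Algebra.TensorProduct.includeRight :
    Skew θ →ₐ[Centre θ] FracCentre θ ⊗[Centre θ] Skew θ).toRingHom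

/-- The inclusion of `Frac(Z)` in `Frac(A)`. -/
def ofFracCentre : FracCentre θ →+* FracSkew θ :=
  Algebra.TensorProduct.includeLeftRingHom

/-- The derivative `d/dY` on `F(Y)`. -/
def ratDeriv {F : Type*} [Field F] (W : RatFunc F) : RatFunc F :=
  algebraMap (Polynomial F) (RatFunc F)
      (Polynomial.derivative W.num * W.denom - W.num * Polynomial.derivative W.denom) /
    algebraMap (Polynomial F) (RatFunc F) (W.denom ^ 2)

/-! ### Points and the quotients `A / N A` -/

variable {Fs : Type*} [Field Fs] [Algebra (FixedField θ) Fs]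

/-- The ideal `N A` of `A`, where `N ∈ F[Y]` is the minimal polynomial of `z` over `F`. -/
def pointIdeal (z : Fs) : Ideal (Skew θ) :=
  Ideal.span {algebraMap (Centre θ) (Skew θ) (Polynomial.toLaurent (minpoly (FixedField θ) z))}

instance (z : Fs) : (pointIdeal θ z).IsTwoSided where
  mul_mem_of_left {a} b ha := by
    obtain ⟨c, rfl⟩ := Ideal.mem_span_singleton'.1 ha
    rw [mul_assoc, Algebra.commutes, ← mul_assoc]
    exact Ideal.mul_mem_left _ _ (Ideal.subset_span rfl)

/-- The ring `A / N A`, where `N` is the minimal polynomial of `z`. -/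
abbrev QuotSkew (z : Fs) := Skew θ ⧸ pointIdeal θ z

/-- The reduction `A → A / N A`. -/
abbrev red (z : Fs) : Skew θ →+* QuotSkew θ z := Ideal.Quotient.mk (pointIdeal θ z)

variable [IsSepClosure (FixedField θ) Fs]

instance (z : Fs) : Fact (Irreducible (minpoly (FixedField θ) z)) :=
  have : Algebra.IsSeparable (FixedField θ) Fs := IsSepClosure.separable
  ⟨minpoly.irreducible (Algebra.IsIntegral.isIntegral z)⟩

/-- The residue field `E = F[Y] / (N) = Z / N Z` at `z`. -/
abbrev ResField (z : Fs) := AdjoinRoot (minpoly (FixedField θ) z)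

/-- The image of `Y` in the residue field at `z` (it corresponds to `z`). -/
abbrev ybar (z : Fs) : ResField θ z := AdjoinRoot.root _

theorem ybar_ne_zero {z : Fs} (hz : z ≠ 0) : ybar θ z ≠ 0 := by
  intro h
  have h2 : minpoly (FixedField θ) z ∣ Polynomial.X := by
    rw [← AdjoinRoot.mk_eq_zero, AdjoinRoot.mk_X]
    exact h
  have := minpoly.aeval (FixedField θ) z
  obtain ⟨q, hq⟩ := h2
  apply hz
  have h3 := congrArg (Polynomial.aeval z) hq
  simpa [this] using h3

/-- The inclusion `Z / N Z → A / N A`. -/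
def resHom (z : Fs) : ResField θ z →+* QuotSkew θ z :=
  Ideal.Quotient.lift (Ideal.span {minpoly (FixedField θ) z})
    ((red θ z).comp ((algebraMap (Centre θ) (Skew θ)).comp
      (Polynomial.toLaurent : Polynomial (FixedField θ) →+* Centre θ)))
    (by
      intro a ha
      obtain ⟨c, rfl⟩ := Ideal.mem_span_singleton'.1 ha
      change red θ z (algebraMap (Centre θ) (Skew θ) (Polynomial.toLaurent _)) = 0
      rw [map_mul, map_mul]
      exact Ideal.Quotient.eq_zero_iff_mem.2
        (Ideal.mul_mem_left _ _ (Ideal.subset_span rfl)))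

theorem resHom_mk (z : Fs) (P : Polynomial (FixedField θ)) :
    resHom θ z (AdjoinRoot.mk _ P) =
      red θ z (algebraMap (Centre θ) (Skew θ) (Polynomial.toLaurent P)) := rfl

theorem resHom_ybar (z : Fs) : resHom θ z (ybar θ z) = red θ z (X θ ^ orderOf θ : (Skew θ)ˣ) := by
  rw [ybar, ← AdjoinRoot.mk_X, resHom_mk, Polynomial.toLaurent_X]
  congr 1
  rw [← zpow_natCast, X_zpow]
  exact (centreHom_single θ 1 1).trans (by simp)

theorem resHom_of (z : Fs) (a : FixedField θ) :
    resHom θ z (algebraMap _ _ a) = red θ z (ofK θ (a : K)) := by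
  change resHom θ z (AdjoinRoot.mk _ (Polynomial.C a)) = _
  rw [resHom_mk, Polynomial.toLaurent_C]
  congr 1
  exact (centreHom_single θ 0 a).trans (by rw [mul_zero]; rfl)

theorem resHom_commute (z : Fs) (a : ResField θ z) (b : QuotSkew θ z) :
    Commute (resHom θ z a) b := by
  obtain ⟨P, rfl⟩ := AdjoinRoot.mk_surjective a
  obtain ⟨x, rfl⟩ := Ideal.Quotient.mk_surjective b
  rw [resHom_mk]
  exact (Algebra.commute_algebraMap_left _ x).map (red θ z)

/-! ### Canonical Taylor expansions -/

variable {θ} (hp : ¬ ringChar K ∣ orderOf θ)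

variable (θ) in
/-- The ring `(A / N A)((T))`. -/
def Target (z : Fs) : Type _ := LaurentSeries (QuotSkew θ z)

variable (θ) in
instance (z : Fs) : Ring (Target θ z) := inferInstanceAs (Ring (LaurentSeries (QuotSkew θ z)))

variable (θ) in
/-- Constant series. -/
def constT (z : Fs) : QuotSkew θ z →+* Target θ z :=
  (HahnSeries.C : QuotSkew θ z →+* LaurentSeries (QuotSkew θ z))

variable (θ) in
/-- Series with coefficients in `Z / N Z`. -/
def serT (z : Fs) : LaurentSeries (ResField θ z) →+* Target θ z := laurentMap (resHom θ z)

variable (θ) in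
theorem serT_commute (z : Fs) (s : LaurentSeries (ResField θ z)) (b : QuotSkew θ z) :
    Commute (serT θ z s) (constT θ z b) := by
  refine commute_laurent (R := QuotSkew θ z) _ _ fun m n => ?_
  exact resHom_commute θ z _ _

variable (θ) in
theorem serT_C (z : Fs) (a : ResField θ z) :
    serT θ z (HahnSeries.C a) = constT θ z (resHom θ z a) :=
  laurentMap_single _ _ _

/-- The power series `(1 + T/z)^{1/r}` with coefficients in `Z / N Z`. -/
def canSeries (z : Fs) : PowerSeries (ResField θ z) :=
  PowerSeries.rescale (ybar θ z)⁻¹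
    (PowerSeries.map (algebraMap (FixedField θ) (ResField θ z))
      (rootSeries (orderOf θ) (order_ne_zero hp)))

theorem canSeries_pow (z : Fs) :
    canSeries hp z ^ orderOf θ = 1 + PowerSeries.C (ybar θ z)⁻¹ * PowerSeries.X := by
  rw [canSeries, ← map_pow, ← map_pow, rootSeries_pow]
  simp [PowerSeries.rescale_X]

theorem canSeries_ne_zero (z : Fs) :
    (HahnSeries.ofPowerSeries ℤ _ (canSeries hp z)) ≠ 0 := by
  intro h
  have h1 : canSeries hp z = 0 := HahnSeries.ofPowerSeries_injective (Γ := ℤ) (by simpa using h)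
  have h2 := congrArg PowerSeries.constantCoeff h1
  rw [canSeries, ← PowerSeries.coeff_zero_eq_constantCoeff_apply, PowerSeries.coeff_rescale] at h2
  simp [constantCoeff_rootSeries] at h2

/-- The image `(1 + T/z)^{1/r} X` of `X`, a unit of `(A / N A)((T))`. -/
def imgX (z : Fs) : (Target θ z)ˣ :=
  Units.map (serT θ z).toMonoidHom (Units.mk0 _ (canSeries_ne_zero hp z)) *
    Units.map ((constT θ z).comp (red θ z)).toMonoidHom (X θ)

theorem imgX_val (z : Fs) : (imgX hp z : Target θ z) =
    serT θ z (HahnSeries.ofPowerSeries ℤ _ (canSeries hp z)) *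
      constT θ z (red θ z (X θ : Skew θ)) := rfl

theorem imgX_semiconj_one (z : Fs) (a : K) :
    SemiconjBy (imgX hp z : Target θ z) (constT θ z (red θ z (ofK θ a)))
      (constT θ z (red θ z (ofK θ (θ a)))) := by
  rw [imgX_val]
  refine SemiconjBy.mul_left (serT_commute θ z _ _) ?_
  change _ * _ = _ * _
  rw [← map_mul, ← map_mul, ← map_mul, ← map_mul]
  congr 2
  change mono θ 1 1 * mono θ a 0 = mono θ (θ a) 0 * mono θ 1 1
  simp [mono_mul_mono]

theorem imgX_semiconj (z : Fs) (a : K) (n : ℤ) :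
    SemiconjBy ((imgX hp z ^ n : (Target θ z)ˣ) : Target θ z)
      (constT θ z (red θ z (ofK θ a))) (constT θ z (red θ z (ofK θ ((θ ^ n) a)))) := by
  induction n using Int.induction_on generalizing a with
  | zero => exact SemiconjBy.one_left _
  | succ i ih =>
    rw [zpow_add_one, zpow_add_one, Units.val_mul]
    exact SemiconjBy.mul_left (ih (θ a)) (imgX_semiconj_one hp z a)
  | pred i ih =>
    rw [zpow_sub_one, zpow_sub_one, Units.val_mul]
    refine SemiconjBy.mul_left (ih (θ⁻¹ a)) ?_
    refine SemiconjBy.units_inv_symm_left ?_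
    have h := imgX_semiconj_one hp z (θ⁻¹ a)
    have h' : θ (θ⁻¹ a) = a := RingEquiv.apply_symm_apply θ a
    rwa [h'] at h

/-- The canonical `z`-admissible Taylor morphism, restricted to `A`: the morphism of `K`-algebras
`A → (A / N A)((T))` with `X ↦ (1 + T/z)^{1/r} X`. (Its values are power series, and its extension
to the `N`-adic completion of `A` is not needed to expand elements of `Frac(A)`.) -/
def taylorSkew (z : Fs) : Skew θ →+* Target θ z :=
  letI := zAction θ
  (SkewMonoidAlgebra.liftNCRingHom (k := K) (G := Multiplicative ℤ)
    ((constT θ z).comp ((red θ z).comp (ofK θ)))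
    ((Units.coeHom _).comp (zpowersHom _ (imgX hp z)))
    (fun {x y} => ((imgX_semiconj hp z x y.toAdd).eq).symm) :
      SkewMonoidAlgebra K (Multiplicative ℤ) →+* Target θ z)

theorem taylorSkew_mono (z : Fs) (a : K) (n : ℤ) : taylorSkew hp z (mono θ a n) =
    constT θ z (red θ z (ofK θ a)) * ((imgX hp z ^ n : (Target θ z)ˣ) : Target θ z) := by
  let := zAction θ
  change SkewMonoidAlgebra.liftNC _ _ (SkewMonoidAlgebra.single _ _) = _
  rw [SkewMonoidAlgebra.liftNC_single]
  rfl

variable (θ) in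
/-- The expansion of polynomials in `Y`: the morphism `F[Y] → E((T))`, `Y ↦ z + T`. -/
def taylorPoly (z : Fs) : Polynomial (FixedField θ) →+* LaurentSeries (ResField θ z) :=
  Polynomial.eval₂RingHom
    ((HahnSeries.C : ResField θ z →+* LaurentSeries (ResField θ z)).comp (algebraMap _ _))
    (HahnSeries.C (ybar θ z) + HahnSeries.single 1 1)

variable (θ) in
theorem taylorPoly_injective (z : Fs) : Function.Injective (taylorPoly θ z) := by
  have key : taylorPoly θ z =
      ((HahnSeries.ofPowerSeries ℤ (ResField θ z)).comp
        (Polynomial.coeToPowerSeries.ringHom)).comp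
        ((Polynomial.taylorAlgHom (ybar θ z)).toRingHom.comp
          (Polynomial.mapRingHom (algebraMap (FixedField θ) (ResField θ z)))) := by
    apply Polynomial.ringHom_ext
    · intro a
      simp [taylorPoly]
    · simp [taylorPoly, add_comm]
  rw [key]
  simp only [RingHom.coe_comp]
  refine (HahnSeries.ofPowerSeries_injective.comp ?_).comp (Function.Injective.comp ?_ ?_)
  · intro p q h
    simpa using h
  · exact Polynomial.taylor_injective _
  · exact Polynomial.map_injective _ (RingHom.injective (algebraMap (FixedField θ) (ResField θ z)))

variable (θ) in
/-- The expansion of rational functions in `Y`: the morphism `F(Y) → E((T))`, `Y ↦ z + T`. -/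
def taylorRat (z : Fs) : FracCentre θ →+* LaurentSeries (ResField θ z) :=
  RatFunc.liftRingHom (taylorPoly θ z) (by
    intro P hP
    rw [Submonoid.mem_comap, mem_nonZeroDivisors_iff_ne_zero]
    have := nonZeroDivisors.ne_zero hP
    exact fun h => this (taylorPoly_injective θ z (by rw [h, map_zero])))

variable (θ) in
theorem taylorRat_C (z : Fs) (a : FixedField θ) :
    taylorRat θ z (RatFunc.C a) = HahnSeries.C (algebraMap _ _ a) := by
  rw [← RatFunc.algebraMap_C, taylorRat, RatFunc.liftRingHom_algebraMap]
  simp [taylorPoly]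

variable (θ) in
theorem taylorRat_X (z : Fs) :
    taylorRat θ z RatFunc.X = HahnSeries.C (ybar θ z) + HahnSeries.single 1 1 := by
  rw [← RatFunc.algebraMap_X, taylorRat, RatFunc.liftRingHom_algebraMap]
  simp [taylorPoly]

theorem serT_commute_taylorSkew (z : Fs) (s : LaurentSeries (ResField θ z)) (x : Skew θ) :
    Commute (serT θ z s) (taylorSkew hp z x) := by
  refine skew_induction θ (P := fun x => Commute (serT θ z s) (taylorSkew hp z x)) ?_ ?_ ?_ x
  · rw [map_zero]; exact Commute.zero_right _
  · intro a n
    rw [taylorSkew_mono]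
    refine (serT_commute θ z s _).mul_right ?_
    refine Commute.units_zpow_right ?_ n
    rw [imgX_val]
    refine Commute.mul_right ?_ (serT_commute θ z s _)
    exact (Commute.all s _).map (serT θ z)
  · intro x y hx hy
    rw [map_add]; exact hx.add_right hy

theorem imgX_pow {z : Fs} (hz : z ≠ 0) : (imgX hp z : Target θ z) ^ orderOf θ =
    serT θ z (HahnSeries.C (ybar θ z) + HahnSeries.single 1 1) := by
  rw [imgX_val, (serT_commute θ z _ _).mul_pow, ← map_pow, ← map_pow, canSeries_pow, ← map_pow,
    ← map_pow]
  have h1 : red θ z ((X θ : Skew θ) ^ orderOf θ) = resHom θ z (ybar θ z) := by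
    rw [resHom_ybar, Units.val_pow_eq_pow_val]
  rw [h1, ← serT_C, ← map_mul]
  congr 1
  have hy := ybar_ne_zero θ hz
  rw [map_add, map_mul, map_one, HahnSeries.ofPowerSeries_C, HahnSeries.ofPowerSeries_X, add_mul,
    one_mul, mul_right_comm, ← map_mul, inv_mul_cancel₀ hy, map_one, one_mul]

/-- The expansions of `F(Y)` and of `A` agree on `F[Y^{±1}]`. -/
theorem taylor_compat {z : Fs} (hz : z ≠ 0) (c : Centre θ) :
    serT θ z (taylorRat θ z (algebraMap (Centre θ) (FracCentre θ) c)) =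
      taylorSkew hp z (algebraMap (Centre θ) (Skew θ) c) := by
  refine AddMonoidAlgebra.induction_linear (motive := fun c =>
    serT θ z (taylorRat θ z (algebraMap (Centre θ) (FracCentre θ) c)) =
      taylorSkew hp z (algebraMap (Centre θ) (Skew θ) c)) c ?_ ?_ ?_
  · simp only [map_zero]
  · intro f g hf hg
    simp only [map_add, hf, hg]
  · intro n a
    have h1 : algebraMap (Centre θ) (Skew θ) (AddMonoidAlgebra.single n a) =
      mono θ a ((orderOf θ : ℤ) * n) := centreHom_single θ n a
    have h2 : algebraMap (Centre θ) (FracCentre θ) (AddMonoidAlgebra.single n a) =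
        RatFunc.C a * RatFunc.X ^ n := by
      have := LaurentPolynomial.single_eq_C_mul_T a n
      rw [this]
      exact (LaurentPolynomial.eval₂_C_mul_T _ _ _ _).trans (by simp)
    have h3 : (Units.mk0 (HahnSeries.C (ybar θ z) + HahnSeries.single 1 1 :
        LaurentSeries (ResField θ z)) (by
          rw [← taylorRat_X]
          exact (map_ne_zero _).2 RatFunc.X_ne_zero)).map (serT θ z).toMonoidHom =
        imgX hp z ^ orderOf θ := by
      ext1
      rw [Units.val_pow_eq_pow_val, imgX_pow hp hz]
      rfl
    rw [h1, h2, taylorSkew_mono, map_mul, map_mul, taylorRat_C, serT_C, resHom_of, map_zpow₀,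
      taylorRat_X, zpow_mul, zpow_natCast, ← h3, ← map_zpow]
    congr 1
    change _ = serT θ z _
    rw [Units.val_zpow_eq_zpow_val]
    rfl

section

variable {z : Fs} (hz : z ≠ 0)

/-- The canonical Taylor expansion `TS_z : Frac(A) = Frac(Z) ⊗_Z A → (A / N A)((T))` at `z ≠ 0`: the
morphism of `K`-algebras with `X ↦ (1 + T/z)^{1/r} X` (hence `Y ↦ z + T`). -/
def taylorCan : FracSkew θ →+* Target θ z :=
  letI : Algebra (Centre θ) (Target θ z) :=
    ((taylorSkew hp z).comp (algebraMap (Centre θ) (Skew θ))).toAlgebra' (fun c x => by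
      change Commute (taylorSkew hp z (algebraMap (Centre θ) (Skew θ) c)) x
      rw [← taylor_compat hp hz]
      exact commute_laurent (R := QuotSkew θ z) _ _ fun m n => resHom_commute θ z _ _)
  (Algebra.TensorProduct.lift
    ({ (serT θ z).comp (taylorRat θ z) with
        commutes' := fun c => taylor_compat hp hz c } :
      FracCentre θ →ₐ[Centre θ] Target θ z)
    ({ taylorSkew hp z with commutes' := fun _ => rfl } : Skew θ →ₐ[Centre θ] Target θ z)
    (fun W x => serT_commute_taylorSkew hp z (taylorRat θ z W) x)).toRingHom

theorem taylorCan_ofSkew (x : Skew θ) :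
    taylorCan hp hz (ofSkew θ x) = taylorSkew hp z x := by
  simp [taylorCan, ofSkew]

theorem taylorCan_ofFracCentre (W : FracCentre θ) :
    taylorCan hp hz (ofFracCentre θ W) = serT θ z (taylorRat θ z W) := by
  simp [taylorCan, ofFracCentre]

/-- The canonical skew residue `sres_{z,can}(f) ∈ A / N A`: the coefficient of `T^{-1}` in the
canonical Taylor expansion of `f` at `z`. -/
def sresCan (f : FracSkew θ) : QuotSkew θ z :=
  HahnSeries.coeff (taylorCan hp hz f : LaurentSeries (QuotSkew θ z)) (-1)

end

/-! ### Change of variables -/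

variable (θ) in
/-- A rational function `W ∈ F(Y)` has neither a zero nor a pole at `Y = z`. -/
def IsRegularAt (W : FracCentre θ) (z : Fs) : Prop :=
  Polynomial.aeval z W.num ≠ 0 ∧ Polynomial.aeval z W.denom ≠ 0

variable (θ) in
/-- The value of `W ∈ F(Y)` at `Y = z`. -/
def valueAt (W : FracCentre θ) (z : Fs) : Fs :=
  Polynomial.aeval z W.num / Polynomial.aeval z W.denom

theorem IsRegularAt.valueAt_ne_zero {W : FracCentre θ} {z : Fs} (h : IsRegularAt θ W z) :
    valueAt θ W z ≠ 0 :=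
  div_ne_zero h.1 h.2

variable (θ) in
/-- `b ∈ A / N A` is the reduction modulo `N` of `g ∈ Frac(A)`: we can write `g = D⁻¹ h` with
`h ∈ A` and `D ∈ F[Y]` not vanishing at `z`, and `b` is the quotient of the images of `h` and `D`
in `A / N A` (where that of `D` is invertible). -/
def ReducesTo (z : Fs) (g : FracSkew θ) (b : QuotSkew θ z) : Prop :=
  ∃ (D : Polynomial (FixedField θ)) (h : Skew θ), Polynomial.aeval z D ≠ 0 ∧
    ofFracCentre θ (algebraMap _ _ D) * g = ofSkew θ h ∧
    red θ z (algebraMap (Centre θ) (Skew θ) (Polynomial.toLaurent D)) * b = red θ z h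

variable (θ) in
/-- The ring homomorphism `g : A / N₁ A → A / N₂ A` is the one induced by the endomorphism `γ` of
`Frac(A)`, where `N₁` and `N₂` are the minimal polynomials of `z₁` and `z₂`. -/
def IsInducedBy (γ : FracSkew θ →+* FracSkew θ) {z₁ z₂ : Fs}
    (g : QuotSkew θ z₁ →+* QuotSkew θ z₂) : Prop :=
  ∀ a : Skew θ, ReducesTo θ z₂ (γ (ofSkew θ a)) (g (red θ z₁ a))

end SkewRes

end

/-! Write `γ(X) = C X` with `C` in `F(Y)`. Since `C` is central, `γ(Y) = W` with `W = C^r Y`. At a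
point `z ≠ 0` where `W` has neither a zero nor a pole, the same holds for `C`
(`IsRegularAt.of_pow_mul_X`). So `γ` reduces to the morphism `X ↦ C(z) X`, which sends the class of
`Y` to `C(z)^r z = W(z)` and hence kills the minimal polynomial of `W(z)` (`redMap`).

Let `u = W(z + T) - W(z)`, a uniformizer because `dW/dY` does not vanish at `z`. The heart of the
matter is that expanding `γ(f)` at `z` amounts to expanding `f` at `W(z)`, substituting `u` for the
variable and applying the reduced `γ` to the coefficients. On `F(Y)` this is `W(z) + u = W(z + T)`.
On `X` it is the identity `C(z) (1 + u/W(z))^{1/r} = C(z + T) (1 + T/z)^{1/r}`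
(`substHom_canSeries`): both sides have `r`-th power `W(z + T)/z` and constant term `C(z)`, and `r`
is invertible, so they coincide.

By additivity `f` may be taken to be `V a X^n` with `V` in `F(Y)`. Its expansion is a series over
the residue field times the class of `a X^n`, so noncommutativity drops out. What remains is the
classical invariance `res(s(u) u') = res(s)` (`coeff_neg_one_substitution`), as `dW/dY` expands to
`u'`. In positive characteristic the vanishing of the residue of `u'/u^(n+1)`, `n ≥ 1`, cannot be
read off from a primitive; it is obtained from Lagrange's identity `coeff_pow_succ_eq`, which
specializes from a universal ring of characteristic zero. -/

noncomputable section

namespace SkewRes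

/-! ### Substitution and residues of Laurent series over fields -/

section Residue

open PowerSeries

/-- Lagrange's identity `[T^n] k^n = [T^(n-1)] k^(n-1) k'`, over a torsion-free ring. -/
theorem coeff_pow_succ_eq_of_charZero {R : Type*} [CommRing R] [IsDomain R] [CharZero R]
    (k : R⟦X⟧) (n : ℕ) :
    coeff (n + 1) (k ^ (n + 1)) = coeff n (k ^ n * derivative R k) := by
  have h := coeff_derivative (k ^ (n + 1)) n
  rw [derivative_pow, Nat.add_sub_cancel, mul_assoc] at h
  have h2 : ((n + 1 : ℕ) : R⟦X⟧) = C ((n + 1 : ℕ) : R) := by simp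
  rw [h2, coeff_C_mul, mul_comm] at h
  have h3 : ((n : R) + 1) ≠ 0 := by exact_mod_cast Nat.succ_ne_zero n
  push_cast at h
  exact (mul_right_cancel₀ h3 h).symm

/-- Lagrange's identity `[T^n] k^n = [T^(n-1)] k^(n-1) k'`, over any commutative ring. -/
theorem coeff_pow_succ_eq {R : Type*} [CommRing R] (k : R⟦X⟧) (n : ℕ) :
    coeff (n + 1) (k ^ (n + 1)) = coeff n (k ^ n * derivative R k) := by
  -- The identity is integral and polynomial in the coefficients of `k`. It therefore holds for a
  -- lift of `k` over a polynomial ring over `ℤ`, a domain of characteristic zero, and specializes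
  -- along `φ`.
  let φ : MvPolynomial R ℤ →+* R := (MvPolynomial.aeval (R := ℤ) (id : R → R)).toRingHom
  have hφ (a : R) : φ (MvPolynomial.X a) = a := by simp [φ]
  obtain ⟨k, rfl⟩ : ∃ k' : (MvPolynomial R ℤ)⟦X⟧, PowerSeries.map φ k' = k :=
    ⟨PowerSeries.mk fun n => MvPolynomial.X (coeff n k), by ext n; simp [hφ]⟩
  have h := congrArg φ (coeff_pow_succ_eq_of_charZero k n)
  have hd : derivative R (PowerSeries.map φ k) = PowerSeries.map φ (derivative _ k) := by
    ext n; simp [coeff_derivative]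
  rwa [← coeff_map, ← coeff_map, map_mul (PowerSeries.map φ), map_pow (PowerSeries.map φ),
    map_pow (PowerSeries.map φ), ← hd] at h

/-- The residue of `u' / u^(n+1)`, for a uniformizer `u = T h`. -/
theorem coeff_pow_mul_derivative {F : Type*} [Field F] {h k : F⟦X⟧} (hk : k * h = 1) (n : ℕ) :
    coeff n (k ^ (n + 1) * derivative F (PowerSeries.X * h)) = if n = 0 then 1 else 0 := by
  have hd : k * derivative F h + h * derivative F k = 0 := by
    have := congrArg (derivative F) hk
    simpa using this
  rw [Derivation.leibniz, derivative_X]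
  simp only [smul_eq_mul, mul_one]
  cases n with
  | zero =>
    have : k ^ (0 + 1) * (PowerSeries.X * derivative F h + h) =
        1 + PowerSeries.X * (k * derivative F h) := by
      linear_combination hk
    rw [this]
    simp
  | succ m =>
    -- Use `k h = 1` and `k h' = -h k'`; Lagrange's identity then cancels the coefficients of the
    -- two terms.
    have : k ^ (m + 1 + 1) * (PowerSeries.X * derivative F h + h) =
        k ^ (m + 1) - PowerSeries.X * (k ^ m * derivative F k) := by
      linear_combination k ^ (m + 1) * hk + PowerSeries.X * k ^ (m + 1) * hd -
        PowerSeries.X * k ^ m * derivative F k * hk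
    rw [this, map_sub, coeff_succ_X_mul, coeff_pow_succ_eq]
    simp

theorem coeff_neg_one_ofPowerSeries {F : Type*} [Ring F] (p : F⟦X⟧) :
    (HahnSeries.ofPowerSeries ℤ F p).coeff (-1) = 0 := by
  rw [PowerSeries.coeff_coe, if_pos (by norm_num)]

theorem coeff_neg_one_single_mul {F : Type*} [Ring F] (p : F⟦X⟧) (m : ℕ) :
    (HahnSeries.single (-((m + 1 : ℕ) : ℤ)) (1 : F) * HahnSeries.ofPowerSeries ℤ F p).coeff (-1) =
      coeff m p := by
  rw [HahnSeries.coeff_single_mul, one_mul]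
  have : (-1 : ℤ) - -((m + 1 : ℕ) : ℤ) = (m : ℕ) := by push_cast; ring
  rw [this, LaurentSeries.coeff_coe_powerSeries]

theorem single_neg_mul_ofPowerSeries_X_pow (F : Type*) [Ring F] (m : ℕ) :
    HahnSeries.single (-(m : ℤ)) (1 : F) *
      HahnSeries.ofPowerSeries ℤ F (PowerSeries.X ^ m) = 1 := by
  rw [HahnSeries.ofPowerSeries_X_pow, HahnSeries.single_mul_single, neg_add_cancel, one_mul]
  rfl

/-- Uniqueness of inverses; it identifies the image of `T^{-m}` under a substitution `T ↦ T h`. -/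
theorem eq_mul_of_mul_eq_one {M : Type*} [CommMonoid M] {a b c x y : M} (h : a * (x * y) = 1)
    (hx : b * x = 1) (hy : c * y = 1) : a = b * c := by
  refine left_inv_eq_right_inv h ?_
  rw [mul_comm, mul_mul_mul_comm, hx, hy, one_mul]

/-- Invariance of the residue under a change of variables `T ↦ u`, where `u` is a uniformizer. -/
theorem coeff_neg_one_substitution {E F : Type*} [Field E] [Field F] (ι : E →+* F) (u : F⟦X⟧)
    (hu : constantCoeff u = 0) (hu1 : coeff 1 u ≠ 0) (ψ : E⟦X⟧ →+* F⟦X⟧)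
    (Ψ : LaurentSeries E →+* LaurentSeries F)
    (hΨ : ∀ p, Ψ (HahnSeries.ofPowerSeries ℤ E p) = HahnSeries.ofPowerSeries ℤ F (ψ p))
    (hψC : ∀ a, ψ (C a) = C (ι a)) (hψX : ψ PowerSeries.X = u) (s : LaurentSeries E) :
    (Ψ s * HahnSeries.ofPowerSeries ℤ F (derivative F u)).coeff (-1) = ι (s.coeff (-1)) := by
  obtain ⟨h, rfl⟩ := PowerSeries.X_dvd_iff.2 hu
  have hh : constantCoeff h ≠ 0 := by
    rwa [← zero_add 1, coeff_succ_X_mul, coeff_zero_eq_constantCoeff_apply] at hu1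
  obtain ⟨k, hk⟩ : ∃ k, k * h = 1 := ⟨h⁻¹, PowerSeries.inv_mul_cancel h hh⟩
  -- No continuity of `Ψ` is needed: the image of `T^{-m}` is forced to be the inverse of `u^m = T^m
  -- h^m`.
  have hneg (m : ℕ) : Ψ (HahnSeries.single (-(m : ℤ)) 1) =
      HahnSeries.single (-(m : ℤ)) 1 * HahnSeries.ofPowerSeries ℤ F (k ^ m) := by
    have h1 := single_neg_mul_ofPowerSeries_X_pow E m
    have h2 := single_neg_mul_ofPowerSeries_X_pow F m
    have h3 := congrArg Ψ h1
    rw [map_mul Ψ, map_one Ψ, hΨ, map_pow ψ, hψX] at h3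
    have h4 : HahnSeries.ofPowerSeries ℤ F (k ^ m) *
        HahnSeries.ofPowerSeries ℤ F (h ^ m) = 1 := by
      rw [← map_mul, ← mul_pow, hk, one_pow, map_one]
    rw [mul_pow, map_mul] at h3
    exact eq_mul_of_mul_eq_one h3 h2 h4
  -- Induction on a bound `m` for the pole order. Splitting off the constant term of `p` turns
  -- `T^{-(m+1)} p` into `T^{-m}` times a power series, covered by induction, plus a multiple of
  -- `T^{-(m+1)}`, computed by `coeff_pow_mul_derivative`.
  have key (m : ℕ) : ∀ p : E⟦X⟧,
      (Ψ (HahnSeries.single (-(m : ℤ)) 1 * HahnSeries.ofPowerSeries ℤ E p) *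
        HahnSeries.ofPowerSeries ℤ F (derivative F (PowerSeries.X * h))).coeff (-1) =
      ι ((HahnSeries.single (-(m : ℤ)) 1 * HahnSeries.ofPowerSeries ℤ E p).coeff (-1)) := by
    induction m with
    | zero =>
      intro p
      have h1 {G : Type _} [Ring G] : HahnSeries.single (-((0 : ℕ) : ℤ)) (1 : G) = 1 := by simp
      rw [h1, one_mul, hΨ, ← map_mul, coeff_neg_one_ofPowerSeries, coeff_neg_one_ofPowerSeries,
        map_zero]
    | succ m ih =>
      intro p
      have hX : HahnSeries.single (-((m + 1 : ℕ) : ℤ)) (1 : E) *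
          HahnSeries.ofPowerSeries ℤ E PowerSeries.X = HahnSeries.single (-(m : ℤ)) 1 := by
        rw [HahnSeries.ofPowerSeries_X, HahnSeries.single_mul_single]; simp
      have hp : p = PowerSeries.X * PowerSeries.mk (fun n => coeff (n + 1) p) +
          C (constantCoeff p) := PowerSeries.eq_X_mul_shift_add_const p
      rw [hp, map_add, mul_add, map_mul (HahnSeries.ofPowerSeries ℤ E), ← mul_assoc, hX, map_add Ψ,
        add_mul, HahnSeries.coeff_add, HahnSeries.coeff_add, map_add ι, ih]
      congr 1
      rw [coeff_neg_one_single_mul, map_mul Ψ, hneg, hΨ, hψC, mul_assoc, mul_assoc, ← map_mul,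
        ← map_mul, coeff_neg_one_single_mul, mul_left_comm, coeff_C_mul,
        coeff_pow_mul_derivative hk, coeff_C]
      split_ifs <;> simp
  -- Every Laurent series has the form treated by `key`; for nonnegative order the power of `T` is
  -- absorbed into `p` and `m = 0`.
  rcases le_total 0 s.order with h0 | h0
  · obtain ⟨n, hn⟩ := Int.eq_ofNat_of_zero_le h0
    have h2 := LaurentSeries.single_order_mul_powerSeriesPart s
    have h3 := key 0 (PowerSeries.X ^ n * s.powerSeriesPart)
    have h4 : HahnSeries.single (-((0 : ℕ) : ℤ)) (1 : E) = 1 := by simp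
    rw [hn] at h2
    rwa [h4, one_mul, map_mul, HahnSeries.ofPowerSeries_X_pow, h2] at h3
  · obtain ⟨n, hn⟩ := Int.exists_eq_neg_ofNat h0
    have h2 := LaurentSeries.single_order_mul_powerSeriesPart s
    rw [hn] at h2
    have h3 := key n s.powerSeriesPart
    rwa [h2] at h3

/-- Substitution of `u` in power series, with a change of coefficients. -/
def substHom {E F : Type*} [Field E] [Field F] (ι : E →+* F) {u : F⟦X⟧}
    (hu : constantCoeff u = 0) : E⟦X⟧ →+* F⟦X⟧ :=
  (substAlgHom (R := F) (HasSubst.of_constantCoeff_zero' hu)).toRingHom.comp (PowerSeries.map ι)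

theorem substHom_C {E F : Type*} [Field E] [Field F] (ι : E →+* F) {u : F⟦X⟧}
    (hu : constantCoeff u = 0) (a : E) : substHom ι hu (C a) = C (ι a) := by
  have := (substAlgHom (R := F) (HasSubst.of_constantCoeff_zero' hu)).commutes (ι a)
  simpa [substHom] using this

theorem substHom_X {E F : Type*} [Field E] [Field F] (ι : E →+* F) {u : F⟦X⟧}
    (hu : constantCoeff u = 0) : substHom ι hu PowerSeries.X = u := by
  have := substAlgHom_X (R := F) (HasSubst.of_constantCoeff_zero' hu)
  simpa [substHom] using this

theorem constantCoeff_substHom {E F : Type*} [Field E] [Field F] (ι : E →+* F) {u : F⟦X⟧}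
    (hu : constantCoeff u = 0) (p : E⟦X⟧) :
    constantCoeff (substHom ι hu p) = ι (constantCoeff p) := by
  conv_lhs => rw [PowerSeries.eq_X_mul_shift_add_const p]
  rw [map_add, map_mul, substHom_X, substHom_C]
  simp [hu]

/-- Substitution of a nonzero series `u` without constant term in Laurent series, with a change of
coefficients. -/
def substLaurent {E F : Type*} [Field E] [Field F] (ι : E →+* F) {u : F⟦X⟧}
    (hu : constantCoeff u = 0) (hu0 : u ≠ 0) : LaurentSeries E →+* LaurentSeries F :=
  -- Laurent series are power series with `T` inverted, so the extension only requires `u` to be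
  -- invertible.
  IsLocalization.lift (M := Submonoid.powers (PowerSeries.X : E⟦X⟧))
    (g := (HahnSeries.ofPowerSeries ℤ F).comp (substHom ι hu)) (by
      rintro ⟨_, n, rfl⟩
      change IsUnit ((HahnSeries.ofPowerSeries ℤ F) (substHom ι hu (PowerSeries.X ^ n)))
      rw [map_pow, map_pow, substHom_X]
      refine (IsUnit.mk0 _ ?_).pow n
      exact (map_ne_zero_iff _ HahnSeries.ofPowerSeries_injective).2 hu0)

theorem substLaurent_ofPowerSeries {E F : Type*} [Field E] [Field F] (ι : E →+* F) {u : F⟦X⟧}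
    (hu : constantCoeff u = 0) (hu0 : u ≠ 0) (p : E⟦X⟧) :
    substLaurent ι hu hu0 (HahnSeries.ofPowerSeries ℤ E p) =
      HahnSeries.ofPowerSeries ℤ F (substHom ι hu p) :=
  IsLocalization.lift_eq (M := Submonoid.powers (PowerSeries.X : E⟦X⟧)) _ p

/-- Roots of power series are determined by their constant terms. -/
theorem eq_of_pow_eq {F : Type*} [Field F] {r : ℕ} (hr : (r : F) ≠ 0) {f g : F⟦X⟧}
    (hf : constantCoeff f ≠ 0) (hfg : constantCoeff f = constantCoeff g) (h : f ^ r = g ^ r) :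
    f = g := by
  have h1 := (Commute.all f g).mul_geom_sum₂ r
  rw [h, sub_self] at h1
  -- The cofactor of `f - g` in `f^r - g^r` has constant term `r f(0)^(r-1)`, which is nonzero.
  refine sub_eq_zero.1 ((mul_eq_zero.1 h1).resolve_right fun h2 => ?_)
  have h3 := congrArg constantCoeff h2
  simp only [map_sum, map_mul, map_pow, ← hfg, ← pow_add, map_zero] at h3
  rw [Finset.sum_congr rfl (g := fun _ => constantCoeff f ^ (r - 1)) (fun i hi => by
    have := Finset.mem_range.1 hi
    congr 1; omega)] at h3
  simp [hr, hf] at h3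

end Residue

section Expansion

open PowerSeries (constantCoeff derivative)

variable {K : Type*} [Field K] {θ : RingAut K} {Fs : Type*} [Field Fs]
  [Algebra (FixedField θ) Fs] [IsSepClosure (FixedField θ) Fs]

/-! ### Expansions of rational functions -/

variable (θ) in
/-- The embedding of the residue field at `z` in the separable closure, `Y ↦ z`. -/
def resEmb (z : Fs) : ResField θ z →+* Fs :=
  AdjoinRoot.lift (algebraMap (FixedField θ) Fs) z (minpoly.aeval (FixedField θ) z)

theorem resEmb_mk (z : Fs) (P : Polynomial (FixedField θ)) :
    resEmb θ z (AdjoinRoot.mk _ P) = Polynomial.aeval z P :=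
  AdjoinRoot.lift_mk _ _

variable (θ) in
/-- The expansion `Y ↦ z + T` of polynomials in `Y`, as a power series. -/
def taylorPow (z : Fs) : Polynomial (FixedField θ) →+* PowerSeries (ResField θ z) :=
  (Polynomial.coeToPowerSeries.ringHom).comp
    ((Polynomial.taylorAlgHom (ybar θ z)).toRingHom.comp
      (Polynomial.mapRingHom (algebraMap (FixedField θ) (ResField θ z))))

theorem taylorPow_C (z : Fs) (a : FixedField θ) :
    taylorPow θ z (Polynomial.C a) = PowerSeries.C (algebraMap _ _ a) := by
  simp [taylorPow]

theorem taylorPow_X (z : Fs) :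
    taylorPow θ z Polynomial.X = PowerSeries.C (ybar θ z) + PowerSeries.X := by
  simp [taylorPow, add_comm]

theorem ofPowerSeries_taylorPow (z : Fs) (P : Polynomial (FixedField θ)) :
    HahnSeries.ofPowerSeries ℤ _ (taylorPow θ z P) = taylorPoly θ z P := by
  have : (HahnSeries.ofPowerSeries ℤ _).comp (taylorPow θ z) = taylorPoly θ z := by
    apply Polynomial.ringHom_ext
    · intro a
      simp [taylorPow_C, taylorPoly]
    · simp [taylorPow_X, taylorPoly]
  exact congrArg (fun f => f P) this

theorem constantCoeff_taylorPow (z : Fs) (P : Polynomial (FixedField θ)) :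
    constantCoeff (taylorPow θ z P) = AdjoinRoot.mk _ P := by
  have : constantCoeff.comp (taylorPow θ z) = AdjoinRoot.mk _ := by
    apply Polynomial.ringHom_ext
    · intro a
      simp only [RingHom.comp_apply, taylorPow_C, PowerSeries.constantCoeff_C]
      rfl
    · simp [taylorPow_X]
  exact congrArg (fun f => f P) this

theorem derivative_taylorPow (z : Fs) (P : Polynomial (FixedField θ)) :
    derivative _ (taylorPow θ z P) = taylorPow θ z (Polynomial.derivative P) := by
  induction P using Polynomial.induction_on' with
  | add p q hp hq => simp only [map_add, hp, hq]
  | monomial n a =>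
    rw [Polynomial.derivative_monomial, ← Polynomial.C_mul_X_pow_eq_monomial,
      ← Polynomial.C_mul_X_pow_eq_monomial, map_mul (taylorPow θ z), map_mul (taylorPow θ z),
      map_pow (taylorPow θ z), map_pow (taylorPow θ z), taylorPow_C, taylorPow_C, taylorPow_X,
      Derivation.leibniz, PowerSeries.derivative_pow]
    simp
    ring

theorem constantCoeff_taylorPow_ne_zero {z : Fs} {P : Polynomial (FixedField θ)}
    (h : Polynomial.aeval z P ≠ 0) : constantCoeff (taylorPow θ z P) ≠ 0 := by
  rw [constantCoeff_taylorPow]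
  intro h0
  apply h
  rw [← resEmb_mk, h0, map_zero]

theorem taylorRat_algebraMap (z : Fs) (P : Polynomial (FixedField θ)) :
    taylorRat θ z (algebraMap _ _ P) = HahnSeries.ofPowerSeries ℤ _ (taylorPow θ z P) := by
  rw [ofPowerSeries_taylorPow, taylorRat, RatFunc.liftRingHom_algebraMap]

variable (θ) in
/-- The expansion at `z` of a rational function without a pole at `z`, as a power series. -/
def taylorReg (z : Fs) (V : FracCentre θ) : PowerSeries (ResField θ z) :=
  taylorPow θ z V.num * (taylorPow θ z V.denom)⁻¹

theorem taylorReg_mul {V : FracCentre θ} {z : Fs} (h : IsRegularAt θ V z) :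
    taylorReg θ z V * taylorPow θ z V.denom = taylorPow θ z V.num := by
  rw [taylorReg, mul_assoc, PowerSeries.inv_mul_cancel _ (constantCoeff_taylorPow_ne_zero h.2),
    mul_one]

theorem algebraMap_denom_ne_zero (V : FracCentre θ) :
    algebraMap (Polynomial (FixedField θ)) (FracCentre θ) V.denom ≠ 0 :=
  RatFunc.algebraMap_ne_zero V.denom_ne_zero

theorem mul_algebraMap_denom (V : FracCentre θ) :
    V * algebraMap (Polynomial (FixedField θ)) (FracCentre θ) V.denom =
      algebraMap (Polynomial (FixedField θ)) (FracCentre θ) V.num := by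
  exact (div_eq_iff (algebraMap_denom_ne_zero V)).1 (RatFunc.num_div_denom V) |>.symm

theorem ofPowerSeries_taylorPow_ne_zero {z : Fs} {P : Polynomial (FixedField θ)}
    (h : Polynomial.aeval z P ≠ 0) : HahnSeries.ofPowerSeries ℤ _ (taylorPow θ z P) ≠ 0 := by
  refine (map_ne_zero_iff _ HahnSeries.ofPowerSeries_injective).2 fun h0 => ?_
  apply constantCoeff_taylorPow_ne_zero h
  rw [h0, map_zero]

theorem ofPowerSeries_taylorReg {V : FracCentre θ} {z : Fs} (h : IsRegularAt θ V z) :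
    HahnSeries.ofPowerSeries ℤ _ (taylorReg θ z V) = taylorRat θ z V := by
  have h1 := congrArg (taylorRat θ z) (mul_algebraMap_denom V)
  rw [map_mul, taylorRat_algebraMap, taylorRat_algebraMap, ← taylorReg_mul h, map_mul] at h1
  exact (mul_right_cancel₀ (ofPowerSeries_taylorPow_ne_zero h.2) h1).symm

theorem resEmb_constantCoeff_taylorReg {V : FracCentre θ} {z : Fs} (h : IsRegularAt θ V z) :
    resEmb θ z (constantCoeff (taylorReg θ z V)) = valueAt θ V z := by
  have h1 := congrArg (fun p => resEmb θ z (constantCoeff p)) (taylorReg_mul h)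
  simp only [map_mul, constantCoeff_taylorPow, resEmb_mk] at h1
  rw [valueAt, eq_div_iff h.2, h1]

theorem constantCoeff_taylorReg_ne_zero {V : FracCentre θ} {z : Fs} (h : IsRegularAt θ V z) :
    constantCoeff (taylorReg θ z V) ≠ 0 := by
  intro h0
  apply h.valueAt_ne_zero
  rw [← resEmb_constantCoeff_taylorReg h, h0, map_zero]

/-- Differentiating (expansion of `V`) · (denominator) = (numerator) recovers the quotient rule by
which `ratDeriv` is defined. -/
theorem taylorRat_ratDeriv {V : FracCentre θ} {z : Fs} (h : IsRegularAt θ V z) :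
    taylorRat θ z (ratDeriv V) =
      HahnSeries.ofPowerSeries ℤ _ (derivative _ (taylorReg θ z V)) := by
  have h0 := taylorReg_mul h
  have h1 := congrArg (derivative _) h0
  rw [Derivation.leibniz, derivative_taylorPow, derivative_taylorPow] at h1
  simp only [smul_eq_mul] at h1
  rw [ratDeriv, map_div₀, taylorRat_algebraMap, taylorRat_algebraMap, div_eq_iff, ← map_mul]
  · congr 1
    rw [map_sub, map_mul, map_mul, map_pow, ← h0, ← h1]
    ring
  · rw [map_pow, map_pow]
    exact pow_ne_zero _ (ofPowerSeries_taylorPow_ne_zero h.2)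

/-- Since `x / 0 = 0`, a nonzero value also excludes a pole. The hypothesis on `dW/dY` thus makes it
regular at `z`. -/
theorem IsRegularAt.of_valueAt_ne_zero {V : FracCentre θ} {z : Fs} (h : valueAt θ V z ≠ 0) :
    IsRegularAt θ V z :=
  ⟨fun h0 => h (by rw [valueAt, h0, zero_div]), fun h0 => h (by rw [valueAt, h0, div_zero])⟩

/-- This constant term is the linear coefficient of `V(z + T) - V(z)`, so that series is a
uniformizer. -/
theorem constantCoeff_derivative_taylorReg_ne_zero {V : FracCentre θ} {z : Fs}
    (h : IsRegularAt θ V z) (hd : valueAt θ (ratDeriv V) z ≠ 0) :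
    constantCoeff (derivative _ (taylorReg θ z V)) ≠ 0 := by
  have h1 := taylorRat_ratDeriv h
  have h2 := IsRegularAt.of_valueAt_ne_zero hd
  rw [← ofPowerSeries_taylorReg h2] at h1
  rw [← HahnSeries.ofPowerSeries_injective h1]
  exact constantCoeff_taylorReg_ne_zero h2

/-- If `C^r Y` is regular at `z ≠ 0`, then so is `C`. -/
theorem IsRegularAt.of_pow_mul_X {C : FracCentre θ} {r : ℕ} (hr : r ≠ 0) {z : Fs} (hz : z ≠ 0)
    (h : IsRegularAt θ (C ^ r * RatFunc.X) z) : IsRegularAt θ C z := by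
  set W : FracCentre θ := C ^ r * RatFunc.X with hW
  have h1 := mul_algebraMap_denom W
  have h2 := mul_algebraMap_denom C
  have h3 : C.num ^ r * Polynomial.X * W.denom = W.num * C.denom ^ r := by
    apply RatFunc.algebraMap_injective
    rw [map_mul, map_mul, map_mul, map_pow, map_pow, ← h1, ← h2, RatFunc.algebraMap_X]
    rw [hW]
    ring
  have h4 := congrArg (Polynomial.aeval z) h3
  simp only [map_mul, map_pow, Polynomial.aeval_X] at h4
  -- Numerator and denominator are coprime. In each case below, the relation `h4` would force both
  -- to vanish at `z`.
  have hco : ¬ (Polynomial.aeval z C.num = 0 ∧ Polynomial.aeval z C.denom = 0) := by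
    rintro ⟨ha, hb⟩
    obtain ⟨a, b, hab⟩ := RatFunc.isCoprime_num_denom C
    have := congrArg (Polynomial.aeval z) hab
    simp [ha, hb] at this
  refine ⟨fun h0 => ?_, fun h0 => ?_⟩
  · rw [h0, zero_pow hr, zero_mul, zero_mul, eq_comm, mul_eq_zero, pow_eq_zero_iff hr] at h4
    exact hco ⟨h0, h4.resolve_left h.1⟩
  · rw [h0, zero_pow hr, mul_zero, mul_eq_zero, mul_eq_zero, pow_eq_zero_iff hr] at h4
    exact hco ⟨(h4.resolve_right h.2).resolve_right hz, h0⟩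

/-! ### The change of residue fields -/

variable {W : FracCentre θ} {z : Fs}

/-- The morphism `F(W(z)) → F(z)` of residue fields, `Y ↦ W(z)`. -/
def resMap (h : IsRegularAt θ W z) : ResField θ (valueAt θ W z) →+* ResField θ z :=
  AdjoinRoot.lift (algebraMap (FixedField θ) (ResField θ z)) (constantCoeff (taylorReg θ z W)) (by
    -- The relation is tested in `Fs`, where the constant term of the expansion becomes the value
    -- `W(z)`.
    apply (resEmb θ z).injective
    have h0 : (resEmb θ z).comp (algebraMap (FixedField θ) (ResField θ z)) =
        algebraMap (FixedField θ) Fs := by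
      ext a
      exact (resEmb_mk z (Polynomial.C a)).trans (by simp)
    rw [Polynomial.hom_eval₂, resEmb_constantCoeff_taylorReg h, h0, map_zero]
    exact minpoly.aeval _ _)

theorem resMap_ybar (h : IsRegularAt θ W z) :
    resMap h (ybar θ (valueAt θ W z)) = constantCoeff (taylorReg θ z W) :=
  AdjoinRoot.lift_root _

theorem resMap_algebraMap (h : IsRegularAt θ W z) (a : FixedField θ) :
    resMap h (algebraMap _ _ a) = algebraMap _ _ a :=
  AdjoinRoot.lift_of _

variable (θ) in
/-- The uniformizer `W(z + T) - W(z)`. -/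
def unif (z : Fs) (W : FracCentre θ) : PowerSeries (ResField θ z) :=
  taylorReg θ z W - PowerSeries.C (constantCoeff (taylorReg θ z W))

theorem constantCoeff_unif : constantCoeff (unif θ z W) = 0 := by simp [unif]

theorem derivative_unif : derivative _ (unif θ z W) = derivative _ (taylorReg θ z W) := by
  simp [unif]

theorem coeff_one_unif_ne_zero (h : IsRegularAt θ W z) (hd : valueAt θ (ratDeriv W) z ≠ 0) :
    PowerSeries.coeff 1 (unif θ z W) ≠ 0 := by
  have h1 := constantCoeff_derivative_taylorReg_ne_zero h hd
  rw [← derivative_unif, ← PowerSeries.coeff_zero_eq_constantCoeff_apply,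
    PowerSeries.coeff_derivative] at h1
  simpa using h1

theorem unif_ne_zero (h : IsRegularAt θ W z) (hd : valueAt θ (ratDeriv W) z ≠ 0) :
    unif θ z W ≠ 0 := by
  intro h0
  apply coeff_one_unif_ne_zero h hd
  rw [h0, map_zero]

/-- The change of variables `T ↦ W(z + T) - W(z)` on Laurent series over the residue fields. -/
def changeVar (h : IsRegularAt θ W z) (hd : valueAt θ (ratDeriv W) z ≠ 0) :
    LaurentSeries (ResField θ (valueAt θ W z)) →+* LaurentSeries (ResField θ z) :=
  substLaurent (resMap h) constantCoeff_unif (unif_ne_zero h hd)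

theorem changeVar_C (h : IsRegularAt θ W z) (hd : valueAt θ (ratDeriv W) z ≠ 0)
    (a : ResField θ (valueAt θ W z)) :
    changeVar h hd (HahnSeries.C a) = HahnSeries.C (resMap h a) := by
  rw [← HahnSeries.ofPowerSeries_C, changeVar, substLaurent_ofPowerSeries, substHom_C,
    HahnSeries.ofPowerSeries_C]

theorem changeVar_taylorRat_X (h : IsRegularAt θ W z) (hd : valueAt θ (ratDeriv W) z ≠ 0) :
    changeVar h hd (taylorRat θ _ RatFunc.X) = taylorRat θ z W := by
  rw [taylorRat_X, map_add, changeVar_C, resMap_ybar, ← HahnSeries.ofPowerSeries_X, changeVar,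
    substLaurent_ofPowerSeries, substHom_X, unif, ← ofPowerSeries_taylorReg h, map_sub,
    HahnSeries.ofPowerSeries_C, add_sub_cancel]

/-- The commutative residue formula: `dW/dY` expands to `u'`, so `coeff_neg_one_substitution`
applies. -/
theorem coeff_changeVar (h : IsRegularAt θ W z) (hd : valueAt θ (ratDeriv W) z ≠ 0)
    (s : LaurentSeries (ResField θ (valueAt θ W z))) :
    (changeVar h hd s * taylorRat θ z (ratDeriv W)).coeff (-1) = resMap h (s.coeff (-1)) := by
  rw [taylorRat_ratDeriv h, ← derivative_unif]
  exact coeff_neg_one_substitution (resMap h) _ constantCoeff_unif (coeff_one_unif_ne_zero h hd)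
    (substHom (resMap h) constantCoeff_unif) _
    (fun p => substLaurent_ofPowerSeries _ _ _ p) (fun a => substHom_C _ _ a) (substHom_X _ _) s

/-! ### The canonical root under a change of variables -/

variable (hp : ¬ ringChar K ∣ orderOf θ)

theorem constantCoeff_canSeries (z : Fs) : constantCoeff (canSeries hp z) = 1 := by
  rw [canSeries, ← PowerSeries.coeff_zero_eq_constantCoeff_apply, PowerSeries.coeff_rescale]
  simp [constantCoeff_rootSeries]

theorem orderOf_ne_zero_of_not_dvd (hp : ¬ ringChar K ∣ orderOf θ) : orderOf θ ≠ 0 := by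
  intro h
  exact hp (h ▸ dvd_zero _)

variable {C : FracCentre θ}

theorem taylorReg_eq_pow_mul {r : ℕ} (hW : W = C ^ r * RatFunc.X) (hC : IsRegularAt θ C z)
    (h : IsRegularAt θ W z) :
    taylorReg θ z W = taylorReg θ z C ^ r * (PowerSeries.C (ybar θ z) + PowerSeries.X) := by
  apply HahnSeries.ofPowerSeries_injective (Γ := ℤ)
  rw [ofPowerSeries_taylorReg h, hW, map_mul, map_mul, map_pow, map_pow,
    ofPowerSeries_taylorReg hC, ← taylorPow_X, ← RatFunc.algebraMap_X, taylorRat_algebraMap]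

theorem constantCoeff_taylorReg_eq {r : ℕ} (hW : W = C ^ r * RatFunc.X)
    (hC : IsRegularAt θ C z) (h : IsRegularAt θ W z) :
    constantCoeff (taylorReg θ z W) = constantCoeff (taylorReg θ z C) ^ r * ybar θ z := by
  rw [taylorReg_eq_pow_mul hW hC h]
  simp

/-- `c(0) (1 + u/W(z))^{1/r} = c(T) (1 + T/z)^{1/r}` if `W = C^r Y`, with `c` the expansion of `C`
and `u` the uniformizer `W(z + T) - W(z)`. -/
theorem substHom_canSeries (hz : z ≠ 0) (hW : W = C ^ orderOf θ * RatFunc.X)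
    (hC : IsRegularAt θ C z) (h : IsRegularAt θ W z) :
    PowerSeries.C (constantCoeff (taylorReg θ z C)) *
        substHom (resMap h) (constantCoeff_unif (z := z) (W := W)) (canSeries hp _) =
      taylorReg θ z C * canSeries hp z := by
  have hr : ((orderOf θ : ℕ) : ResField θ z) ≠ 0 := by
    have := (map_ne_zero (algebraMap (FixedField θ) (ResField θ z))).2 (order_ne_zero hp)
    rwa [map_natCast] at this
  have hc := constantCoeff_taylorReg_ne_zero hC
  have hw := constantCoeff_taylorReg_ne_zero h
  have hy := ybar_ne_zero θ hz
  have h1 := constantCoeff_taylorReg_eq hW hC h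
  have h2 : constantCoeff (taylorReg θ z C) ^ orderOf θ * (constantCoeff (taylorReg θ z W))⁻¹ =
      (ybar θ z)⁻¹ := by
    rw [h1, mul_inv, mul_inv_cancel_left₀ (pow_ne_zero _ hc)]
  have h3 : PowerSeries.C (ybar θ z)⁻¹ * PowerSeries.C (ybar θ z) = 1 := by
    rw [← map_mul, inv_mul_cancel₀ hy, map_one]
  have h4 : PowerSeries.C (constantCoeff (taylorReg θ z W))⁻¹ *
      PowerSeries.C (constantCoeff (taylorReg θ z W)) = 1 := by
    rw [← map_mul, inv_mul_cancel₀ hw, map_one]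
  -- Both sides have `r`-th power `W(z + T)/z`: on the left through `C(z)^r / W(z) = 1/z` (`h2`), on
  -- the right through `W = C^r Y`.
  apply eq_of_pow_eq hr
  · simp [constantCoeff_substHom, constantCoeff_canSeries, hc]
  · simp [constantCoeff_substHom, constantCoeff_canSeries]
  · rw [mul_pow, mul_pow, ← map_pow, ← map_pow (substHom _ _), canSeries_pow, canSeries_pow,
      map_add, map_mul, map_one, substHom_C, substHom_X, map_inv₀, resMap_ybar, unif]
    have h5 := congrArg PowerSeries.C h2
    rw [map_mul] at h5
    have h6 := taylorReg_eq_pow_mul hW hC h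
    linear_combination (taylorReg θ z W) * h5 -
      PowerSeries.C (constantCoeff (taylorReg θ z C) ^ orderOf θ) * h4 +
      PowerSeries.C (ybar θ z)⁻¹ * h6 + taylorReg θ z C ^ orderOf θ * h3

end Expansion

section Skew

open PowerSeries (constantCoeff derivative)

variable {K : Type*} [Field K] {θ : RingAut K} {Fs : Type*} [Field Fs]
  [Algebra (FixedField θ) Fs] [IsSepClosure (FixedField θ) Fs]

/-! ### Coefficients of expansions of skew polynomials -/

theorem mono_eq_ofK_mul (a : K) (n : ℤ) :
    mono θ a n = ofK θ a * ((X θ ^ n : (Skew θ)ˣ) : Skew θ) := by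
  rw [X_zpow]
  change _ = mono θ a 0 * mono θ 1 n
  simp [mono_mul_mono]

/-- Negative exponents occur in `X^n`; a power series with nonzero constant term is already
invertible among power series. -/
theorem exists_zpow_ofPowerSeries {F : Type*} [Field F] {p : PowerSeries F}
    (hp : constantCoeff p ≠ 0) (n : ℤ) :
    ∃ q : PowerSeries F, HahnSeries.ofPowerSeries ℤ F p ^ n = HahnSeries.ofPowerSeries ℤ F q ∧
      constantCoeff q = constantCoeff p ^ n := by
  cases n with
  | ofNat n => exact ⟨p ^ n, by simp, by simp⟩
  | negSucc n =>
    refine ⟨p⁻¹ ^ (n + 1), ?_, ?_⟩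
    · have h : HahnSeries.ofPowerSeries ℤ F p * HahnSeries.ofPowerSeries ℤ F p⁻¹ = 1 := by
        rw [← map_mul, PowerSeries.mul_inv_cancel p hp, map_one]
      rw [zpow_negSucc, map_pow, ← inv_pow, ← eq_inv_of_mul_eq_one_right h]
    · rw [zpow_negSucc, map_pow, PowerSeries.constantCoeff_inv, inv_pow]

theorem coeff_serT_mul_constT (z : Fs) (s : LaurentSeries (ResField θ z)) (b : QuotSkew θ z)
    (m : ℤ) : HahnSeries.coeff (serT θ z s * constT θ z b : LaurentSeries (QuotSkew θ z)) m =
      resHom θ z (s.coeff m) * b :=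
  HahnSeries.coeff_mul_single_zero

variable (hp : ¬ ringChar K ∣ orderOf θ)

/-- The series `(1 + T/z)^{1/r}` is central, so its powers separate from the noncommutative factor.
Coefficients can then be computed over the residue field. -/
theorem taylorSkew_mono_eq (z : Fs) (a : K) (n : ℤ) : taylorSkew hp z (mono θ a n) =
    serT θ z (HahnSeries.ofPowerSeries ℤ _ (canSeries hp z) ^ n) *
      constT θ z (red θ z (mono θ a n)) := by
  have hcomm : Commute (Units.map (serT θ z).toMonoidHom (Units.mk0 _ (canSeries_ne_zero hp z)))
      (Units.map ((constT θ z).comp (red θ z)).toMonoidHom (X θ)) := by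
    apply Units.ext
    exact serT_commute θ z _ _
  have h1 : ((imgX hp z ^ n : (Target θ z)ˣ) : Target θ z) =
      serT θ z (HahnSeries.ofPowerSeries ℤ _ (canSeries hp z) ^ n) *
        constT θ z (red θ z ((X θ ^ n : (Skew θ)ˣ) : Skew θ)) := by
    rw [imgX, hcomm.mul_zpow, ← map_zpow, ← map_zpow, Units.val_mul]
    congr 1
    change serT θ z _ = _
    rw [Units.val_zpow_eq_zpow_val]
    rfl
  rw [taylorSkew_mono, h1, mono_eq_ofK_mul, ← mul_assoc, ← (serT_commute θ z _ _).eq, mul_assoc,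
    ← map_mul, ← map_mul]

/-- The root series has constant term `1`, so the Taylor expansion modulo `T` is the reduction
modulo `N`. -/
theorem coeff_zero_taylorSkew (z : Fs) (x : Skew θ) :
    HahnSeries.coeff (taylorSkew hp z x : LaurentSeries (QuotSkew θ z)) 0 = red θ z x := by
  refine skew_induction θ (P := fun x =>
    HahnSeries.coeff (taylorSkew hp z x : LaurentSeries (QuotSkew θ z)) 0 = red θ z x) ?_ ?_ ?_ x
  · rw [map_zero, map_zero]; rfl
  · intro a n
    obtain ⟨q, hq, hq0⟩ := exists_zpow_ofPowerSeries (p := canSeries hp z)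
      (by rw [constantCoeff_canSeries]; exact one_ne_zero) n
    rw [taylorSkew_mono_eq, coeff_serT_mul_constT, hq]
    have h2 : (HahnSeries.ofPowerSeries ℤ _ q).coeff 0 = 1 := by
      have := LaurentSeries.coeff_coe_powerSeries q 0
      rw [Nat.cast_zero] at this
      rw [this, PowerSeries.coeff_zero_eq_constantCoeff_apply, hq0, constantCoeff_canSeries,
        one_zpow]
    rw [h2, map_one, one_mul]
  · intro x y hx hy
    rw [map_add, map_add, ← hx, ← hy]; rfl

/-! ### Reduction of elements of `Frac(A)` -/

theorem ofFracCentre_commute (V : FracCentre θ) (f : FracSkew θ) :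
    Commute (ofFracCentre θ V) f :=
  Algebra.commutes V f

theorem tmul_eq (V : FracCentre θ) (x : Skew θ) :
    (V ⊗ₜ[Centre θ] x : FracSkew θ) = ofFracCentre θ V * ofSkew θ x := by
  simp [ofFracCentre, ofSkew]

theorem algebraMap_toLaurent (P : Polynomial (FixedField θ)) :
    algebraMap (Centre θ) (FracCentre θ) (Polynomial.toLaurent P) =
      algebraMap (Polynomial (FixedField θ)) (FracCentre θ) P := by
  have : (algebraMap (Centre θ) (FracCentre θ)).comp
      (Polynomial.toLaurent : Polynomial (FixedField θ) →+* Centre θ) =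
      algebraMap (Polynomial (FixedField θ)) (FracCentre θ) := by
    apply Polynomial.ringHom_ext
    · intro a
      rw [RingHom.comp_apply, Polynomial.toLaurent_C, RatFunc.algebraMap_C]
      exact LaurentPolynomial.eval₂_C _ _ _
    · rw [RingHom.comp_apply, Polynomial.toLaurent_X, RatFunc.algebraMap_X]
      exact (LaurentPolynomial.eval₂_T _ _ _).trans (by simp)
  exact congrArg (fun f => f P) this

theorem ofSkew_algebraMap (c : Centre θ) :
    ofSkew θ (algebraMap (Centre θ) (Skew θ) c) =
      ofFracCentre θ (algebraMap (Centre θ) (FracCentre θ) c) := by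
  have h1 : ofSkew θ (algebraMap (Centre θ) (Skew θ) c) =
      algebraMap (Centre θ) (FracSkew θ) c :=
    (Algebra.TensorProduct.includeRight :
      Skew θ →ₐ[Centre θ] FracCentre θ ⊗[Centre θ] Skew θ).commutes c
  rw [h1]
  exact Algebra.TensorProduct.algebraMap_apply c

theorem ofSkew_toLaurent (P : Polynomial (FixedField θ)) :
    ofSkew θ (algebraMap (Centre θ) (Skew θ) (Polynomial.toLaurent P)) =
      ofFracCentre θ (algebraMap (Polynomial (FixedField θ)) (FracCentre θ) P) := by
  rw [ofSkew_algebraMap, algebraMap_toLaurent]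

theorem mk_ne_zero_of_aeval_ne_zero {z : Fs} {D : Polynomial (FixedField θ)} (h : Polynomial.aeval z D ≠ 0) :
    AdjoinRoot.mk (minpoly (FixedField θ) z) D ≠ 0 := by
  intro h0
  apply h
  rw [← resEmb_mk, h0, map_zero]

/-- `A / N A` may have zero divisors, but nonzero elements of the residue field map to units. -/
theorem resHom_mul_left_cancel {z : Fs} {e : ResField θ z} (he : e ≠ 0) {b b' : QuotSkew θ z}
    (h : resHom θ z e * b = resHom θ z e * b') : b = b' :=
  ((IsUnit.mk0 e he).map (resHom θ z)).mul_left_cancel h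

/-- Two fractions for `f` give cross-multiplied numerators that agree in `Frac(A)`. The Taylor
expansion is defined there and its constant term is the reduction, so the classes agree in `A / N A`
without appeal to injectivity of `A → Frac(A)`. -/
theorem ReducesTo.unique (hp : ¬ ringChar K ∣ orderOf θ) {z : Fs} (hz : z ≠ 0) {f : FracSkew θ} {b b' : QuotSkew θ z}
    (h : ReducesTo θ z f b) (h' : ReducesTo θ z f b') : b = b' := by
  obtain ⟨D, x, hD, h1, h2⟩ := h
  obtain ⟨D', x', hD', h1', h2'⟩ := h'
  have h3 : ofSkew θ (algebraMap (Centre θ) (Skew θ) (Polynomial.toLaurent D') * x) =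
      ofSkew θ (algebraMap (Centre θ) (Skew θ) (Polynomial.toLaurent D) * x') := by
    rw [map_mul, map_mul, ofSkew_toLaurent, ofSkew_toLaurent, ← h1, ← h1', ← mul_assoc,
      ← mul_assoc, (ofFracCentre_commute _ _).eq]
  have h4 := congrArg (taylorCan hp hz) h3
  rw [taylorCan_ofSkew, taylorCan_ofSkew] at h4
  have h5 := congrArg (fun y : LaurentSeries (QuotSkew θ z) => y.coeff 0) h4
  simp only [coeff_zero_taylorSkew] at h5
  rw [map_mul, map_mul, ← h2, ← h2', ← resHom_mk, ← resHom_mk, ← mul_assoc, ← mul_assoc,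
    ← map_mul (resHom θ z), ← map_mul (resHom θ z), mul_comm] at h5
  exact resHom_mul_left_cancel (mul_ne_zero (mk_ne_zero_of_aeval_ne_zero hD) (mk_ne_zero_of_aeval_ne_zero hD')) h5

theorem ReducesTo.zero (z : Fs) : ReducesTo θ z (0 : FracSkew θ) 0 :=
  ⟨1, 0, by simp, by simp, by simp⟩

theorem ReducesTo.add {z : Fs} {f f' : FracSkew θ} {b b' : QuotSkew θ z}
    (h : ReducesTo θ z f b) (h' : ReducesTo θ z f' b') : ReducesTo θ z (f + f') (b + b') := by
  obtain ⟨D, x, hD, h1, h2⟩ := h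
  obtain ⟨D', x', hD', h1', h2'⟩ := h'
  refine ⟨D * D', algebraMap (Centre θ) (Skew θ) (Polynomial.toLaurent D') * x +
    algebraMap (Centre θ) (Skew θ) (Polynomial.toLaurent D) * x', ?_, ?_, ?_⟩
  · rw [map_mul]; exact mul_ne_zero hD hD'
  · rw [map_add, map_mul (ofSkew θ), map_mul (ofSkew θ), ofSkew_toLaurent, ofSkew_toLaurent, ← h1,
      ← h1', map_mul, map_mul, mul_add, mul_assoc, mul_assoc, ← mul_assoc, ← mul_assoc,
      (ofFracCentre_commute _ (ofFracCentre θ _)).eq]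
    simp only [mul_assoc]
  · rw [map_add, map_mul (red θ z), map_mul (red θ z), ← h2, ← h2']
    simp only [← resHom_mk, map_mul, mul_add]
    rw [← mul_assoc, ← mul_assoc, (resHom_commute θ z _ (resHom θ z _)).eq]

theorem reducesTo_div {z : Fs} {V : FracCentre θ} {P D : Polynomial (FixedField θ)}
    (hD : Polynomial.aeval z D ≠ 0)
    (hV : algebraMap (Polynomial (FixedField θ)) (FracCentre θ) D * V =
      algebraMap (Polynomial (FixedField θ)) (FracCentre θ) P) {e : ResField θ z}
    (he : AdjoinRoot.mk _ D * e = AdjoinRoot.mk _ P) (x : Skew θ) :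
    ReducesTo θ z (ofFracCentre θ V * ofSkew θ x) (resHom θ z e * red θ z x) := by
  refine ⟨D, algebraMap (Centre θ) (Skew θ) (Polynomial.toLaurent P) * x, hD, ?_, ?_⟩
  · rw [← mul_assoc, ← map_mul, hV, map_mul, ofSkew_toLaurent]
  · rw [map_mul (red θ z), ← resHom_mk, ← resHom_mk, ← mul_assoc, ← map_mul, he]

/-- For negative exponents the numerator of `C` becomes the denominator, hence the need for `C` to
have no zero at `z`. -/
theorem reducesTo_zpow_mul {z : Fs} {C : FracCentre θ} (hC : IsRegularAt θ C z) (n : ℤ)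
    (x : Skew θ) : ReducesTo θ z (ofFracCentre θ (C ^ n) * ofSkew θ x)
      (resHom θ z (constantCoeff (taylorReg θ z C) ^ n) * red θ z x) := by
  have h1 := mul_algebraMap_denom C
  have h2 := congrArg constantCoeff (taylorReg_mul hC)
  rw [map_mul, constantCoeff_taylorPow, constantCoeff_taylorPow] at h2
  have hC0 : C ≠ 0 := by
    rintro rfl
    exact hC.1 (by simp)
  have hc := constantCoeff_taylorReg_ne_zero hC
  cases n with
  | ofNat n =>
    refine reducesTo_div (D := C.denom ^ n) (P := C.num ^ n) ?_ ?_ ?_ x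
    · rw [map_pow]; exact pow_ne_zero _ hC.2
    · rw [map_pow, map_pow, ← h1, mul_pow, mul_comm]; simp
    · rw [map_pow, map_pow, ← h2, mul_pow, mul_comm]; simp
  | negSucc n =>
    refine reducesTo_div (D := C.num ^ (n + 1)) (P := C.denom ^ (n + 1)) ?_ ?_ ?_ x
    · rw [map_pow]; exact pow_ne_zero _ hC.1
    · rw [map_pow, map_pow, ← h1, mul_pow, zpow_negSucc, mul_comm,
        inv_mul_cancel_left₀ (pow_ne_zero _ hC0)]
    · rw [map_pow, map_pow, ← h2, mul_pow, zpow_negSucc, mul_comm,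
        inv_mul_cancel_left₀ (pow_ne_zero _ hc)]

/-! ### The morphism `A / N₁ A → A / N₂ A` -/

variable (θ) in
/-- The image `c X` of `X` in `A / N A`, for a unit `c` of the residue field. -/
def twistX (z : Fs) (c : (ResField θ z)ˣ) : (QuotSkew θ z)ˣ :=
  Units.map (resHom θ z).toMonoidHom c * Units.map (red θ z).toMonoidHom (X θ)

theorem twistX_zpow (z : Fs) (c : (ResField θ z)ˣ) (n : ℤ) :
    ((twistX θ z c ^ n : (QuotSkew θ z)ˣ) : QuotSkew θ z) =
      resHom θ z ((c : ResField θ z) ^ n) * red θ z (mono θ 1 n) := by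
  have hcomm : Commute (Units.map (resHom θ z).toMonoidHom c)
      (Units.map (red θ z).toMonoidHom (X θ)) := by
    apply Units.ext
    exact resHom_commute θ z _ _
  rw [twistX, hcomm.mul_zpow, ← map_zpow, ← map_zpow, Units.val_mul, ← X_zpow,
    ← Units.val_zpow_eq_zpow_val]
  rfl

/-- The morphism `A → A / N A`, `X ↦ c X`, for a unit `c` of the residue field. -/
def twistSkew (z : Fs) (c : (ResField θ z)ˣ) : Skew θ →+* QuotSkew θ z :=
  letI := zAction θ
  (SkewMonoidAlgebra.liftNCRingHom (k := K) (G := Multiplicative ℤ)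
    ((red θ z).comp (ofK θ))
    ((Units.coeHom _).comp (zpowersHom _ (twistX θ z c)))
    (fun {a n} => by
      -- The relation `X^n a = θ^n(a) X^n` survives the twist because `c` is central.
      change red θ z (ofK θ ((θ ^ n.toAdd) a)) *
          ((twistX θ z c ^ n.toAdd : (QuotSkew θ z)ˣ) : QuotSkew θ z) =
        ((twistX θ z c ^ n.toAdd : (QuotSkew θ z)ˣ) : QuotSkew θ z) * red θ z (ofK θ a)
      rw [twistX_zpow, mul_assoc, ← map_mul, ← mul_assoc, ← (resHom_commute θ z _ _).eq, mul_assoc,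
        ← map_mul]
      congr 2
      change mono θ _ 0 * mono θ 1 _ = mono θ 1 _ * mono θ a 0
      simp [mono_mul_mono]) :
      SkewMonoidAlgebra K (Multiplicative ℤ) →+* QuotSkew θ z)

theorem twistSkew_mono (z : Fs) (c : (ResField θ z)ˣ) (a : K) (n : ℤ) :
    twistSkew z c (mono θ a n) =
      resHom θ z ((c : ResField θ z) ^ n) * red θ z (mono θ a n) := by
  have h : twistSkew z c (mono θ a n) =
      red θ z (ofK θ a) * ((twistX θ z c ^ n : (QuotSkew θ z)ˣ) : QuotSkew θ z) := by
    let := zAction θ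
    change SkewMonoidAlgebra.liftNC _ _ (SkewMonoidAlgebra.single _ _) = _
    rw [SkewMonoidAlgebra.liftNC_single]
    rfl
  rw [h, twistX_zpow, ← mul_assoc, ← (resHom_commute θ z _ _).eq, mul_assoc, ← map_mul,
    mono_eq_ofK_mul a, X_zpow]

variable {z : Fs} {W C : FracCentre θ}

/-- The value of `C` at `z`, as a unit of the residue field. -/
def unitValue (hC : IsRegularAt θ C z) : (ResField θ z)ˣ :=
  Units.mk0 _ (constantCoeff_taylorReg_ne_zero hC)

/-- It suffices to compare on constants and on `Y = X^r`, whose image `C(z)^r X^r` is the class of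
`W(z)`. Consequently the minimal polynomial of `W(z)` is killed. -/
theorem twistSkew_toLaurent (hW : W = C ^ orderOf θ * RatFunc.X) (hC : IsRegularAt θ C z)
    (h : IsRegularAt θ W z) (P : Polynomial (FixedField θ)) :
    twistSkew z (unitValue hC) (algebraMap (Centre θ) (Skew θ) (Polynomial.toLaurent P)) =
      resHom θ z (resMap h (AdjoinRoot.mk _ P)) := by
  have : ((twistSkew z (unitValue hC)).comp ((algebraMap (Centre θ) (Skew θ)).comp
      (Polynomial.toLaurent : Polynomial (FixedField θ) →+* Centre θ))) =
      (resHom θ z).comp ((resMap h).comp (AdjoinRoot.mk _)) := by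
    apply Polynomial.ringHom_ext
    · intro a
      simp only [RingHom.comp_apply]
      have h1 : algebraMap (Centre θ) (Skew θ) (Polynomial.toLaurent (Polynomial.C a)) =
          mono θ a 0 := by
        rw [Polynomial.toLaurent_C]
        exact (centreHom_single θ 0 a).trans (by rw [mul_zero])
      rw [h1, twistSkew_mono, zpow_zero, map_one, one_mul]
      exact ((congrArg (resHom θ z) (resMap_algebraMap h a)).trans (resHom_of θ z a)).symm
    · simp only [RingHom.comp_apply]
      have h1 : algebraMap (Centre θ) (Skew θ) (Polynomial.toLaurent Polynomial.X) =
          mono θ 1 (orderOf θ : ℤ) := by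
        rw [Polynomial.toLaurent_X]
        exact (centreHom_single θ 1 1).trans (by rw [mul_one]; rfl)
      have h2 := resHom_ybar θ z
      rw [← zpow_natCast, X_zpow] at h2
      rw [h1, twistSkew_mono, AdjoinRoot.mk_X, resMap_ybar, constantCoeff_taylorReg_eq hW hC h,
        map_mul, ← h2, zpow_natCast]
      rfl
  exact congrArg (fun f => f P) this

/-- The morphism `A / N₁ A → A / N₂ A`, `X ↦ C(z) X`, where `N₁` and `N₂` are the minimal
polynomials of `W(z)` and `z`, and `W = C^r Y`. -/
def redMap (hW : W = C ^ orderOf θ * RatFunc.X) (hC : IsRegularAt θ C z)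
    (h : IsRegularAt θ W z) : QuotSkew θ (valueAt θ W z) →+* QuotSkew θ z :=
  Ideal.Quotient.lift (pointIdeal θ (valueAt θ W z)) (twistSkew z (unitValue hC)) (by
    intro a ha
    obtain ⟨c, rfl⟩ := Ideal.mem_span_singleton'.1 ha
    rw [map_mul, twistSkew_toLaurent hW hC h, AdjoinRoot.mk_self, map_zero, map_zero, mul_zero])

theorem redMap_red (hW : W = C ^ orderOf θ * RatFunc.X) (hC : IsRegularAt θ C z)
    (h : IsRegularAt θ W z) (x : Skew θ) :
    redMap hW hC h (red θ _ x) = twistSkew z (unitValue hC) x := rfl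

theorem redMap_resHom (hW : W = C ^ orderOf θ * RatFunc.X) (hC : IsRegularAt θ C z)
    (h : IsRegularAt θ W z) (e : ResField θ (valueAt θ W z)) :
    redMap hW hC h (resHom θ _ e) = resHom θ z (resMap h e) := by
  obtain ⟨P, rfl⟩ := AdjoinRoot.mk_surjective e
  rw [resHom_mk, redMap_red, twistSkew_toLaurent hW hC h]

/-! ### Endomorphisms of `Frac(A)` -/

variable {γ : FracSkew θ →+* FracSkew θ}

theorem map_X_eq
    (hγX : γ (ofSkew θ (X θ)) * ofSkew θ ↑(X θ)⁻¹ = ofFracCentre θ C) :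
    γ (ofSkew θ (X θ)) = ofFracCentre θ C * ofSkew θ (X θ) := by
  rw [← hγX, mul_assoc, ← map_mul, Units.inv_mul, map_one, mul_one]

theorem ofSkew_X_pow_order :
    ofSkew θ (X θ ^ orderOf θ : (Skew θ)ˣ) = ofFracCentre θ RatFunc.X := by
  have h1 : algebraMap (Centre θ) (Skew θ) (Polynomial.toLaurent Polynomial.X) =
      (X θ ^ orderOf θ : (Skew θ)ˣ) := by
    rw [Polynomial.toLaurent_X, ← zpow_natCast, X_zpow]
    exact (centreHom_single θ 1 1).trans (by rw [mul_one]; rfl)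
  rw [← h1, ofSkew_toLaurent, RatFunc.algebraMap_X]

theorem map_X_pow_order
    (hγX : γ (ofSkew θ (X θ)) * ofSkew θ ↑(X θ)⁻¹ = ofFracCentre θ C) :
    γ (ofSkew θ (X θ ^ orderOf θ : (Skew θ)ˣ)) =
      ofFracCentre θ (C ^ orderOf θ * RatFunc.X) := by
  have h1 := ofSkew_X_pow_order (θ := θ)
  rw [Units.val_pow_eq_pow_val, map_pow] at h1
  rw [Units.val_pow_eq_pow_val, map_pow, map_pow, map_X_eq hγX,
    (ofFracCentre_commute C _).mul_pow, h1, map_mul, map_pow]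

/-- `C` commutes with `X`, so `(C X)^n = C^n X^n` for every integer `n`. -/
theorem map_mono_eq
    (hγK : ∀ a : K, γ (ofSkew θ (ofK θ a)) = ofSkew θ (ofK θ a))
    (hγX : γ (ofSkew θ (X θ)) * ofSkew θ ↑(X θ)⁻¹ = ofFracCentre θ C) (hC : C ≠ 0) (a : K)
    (n : ℤ) :
    γ (ofSkew θ (mono θ a n)) = ofFracCentre θ (C ^ n) * ofSkew θ (mono θ a n) := by
  have h1 : Units.map (γ.comp (ofSkew θ)).toMonoidHom (X θ) =
      Units.map (ofFracCentre θ).toMonoidHom (Units.mk0 C hC) *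
        Units.map (ofSkew θ).toMonoidHom (X θ) := by
    apply Units.ext
    exact map_X_eq hγX
  have hcomm : Commute (Units.map (ofFracCentre θ).toMonoidHom (Units.mk0 C hC))
      (Units.map (ofSkew θ).toMonoidHom (X θ)) := by
    apply Units.ext
    exact ofFracCentre_commute C _
  have h2 : γ (ofSkew θ ((X θ ^ n : (Skew θ)ˣ) : Skew θ)) =
      ofFracCentre θ (C ^ n) * ofSkew θ ((X θ ^ n : (Skew θ)ˣ) : Skew θ) := by
    have h3 := congrArg (fun u : (FracSkew θ)ˣ => (u ^ n : (FracSkew θ)ˣ).val) h1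
    simp only [hcomm.mul_zpow, ← map_zpow, Units.val_mul] at h3
    have h4 : ((Units.mk0 C hC ^ n : (FracCentre θ)ˣ) : FracCentre θ) = C ^ n := by
      rw [Units.val_zpow_eq_zpow_val]; rfl
    rw [← h4]
    exact h3
  rw [mono_eq_ofK_mul, map_mul, map_mul, hγK, h2, ← mul_assoc, ← mul_assoc,
    (ofFracCentre_commute _ _).eq]

theorem isInducedBy_redMap
    (hγK : ∀ a : K, γ (ofSkew θ (ofK θ a)) = ofSkew θ (ofK θ a))
    (hγX : γ (ofSkew θ (X θ)) * ofSkew θ ↑(X θ)⁻¹ = ofFracCentre θ C)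
    (hW : W = C ^ orderOf θ * RatFunc.X) (hC : IsRegularAt θ C z) (h : IsRegularAt θ W z) :
    IsInducedBy θ γ (redMap hW hC h) := by
  have hC0 : C ≠ 0 := by
    rintro rfl
    exact hC.1 (by simp)
  intro x
  refine skew_induction θ (P := fun x =>
    ReducesTo θ z (γ (ofSkew θ x)) (redMap hW hC h (red θ _ x))) ?_ ?_ ?_ x
  · simp only [map_zero]
    exact ReducesTo.zero z
  · intro a n
    rw [map_mono_eq hγK hγX hC0, redMap_red, twistSkew_mono]
    exact reducesTo_zpow_mul hC n _
  · intro x y hx hy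
    simp only [map_add]
    exact hx.add hy

/-! ### Change of variables in expansions and residues -/

/-- Two ring homomorphisms on `F(Y)` which agree on `F` and at `Y` are equal. -/
theorem ratFunc_ringHom_ext {F R : Type*} [Field F] [Ring R] {f g : RatFunc F →+* R}
    (hC : ∀ a, f (RatFunc.C a) = g (RatFunc.C a)) (hX : f RatFunc.X = g RatFunc.X) : f = g := by
  have h : f.comp (algebraMap (Polynomial F) (RatFunc F)) =
      g.comp (algebraMap (Polynomial F) (RatFunc F)) := by
    apply Polynomial.ringHom_ext
    · intro a
      simpa using hC a
    · simpa using hX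
  have h' (P : Polynomial F) : f (algebraMap _ _ P) = g (algebraMap _ _ P) :=
    congrArg (fun φ => φ P) h
  ext V
  have hd : algebraMap (Polynomial F) (RatFunc F) V.denom ≠ 0 :=
    RatFunc.algebraMap_ne_zero V.denom_ne_zero
  have hV : V * algebraMap (Polynomial F) (RatFunc F) V.denom =
      algebraMap (Polynomial F) (RatFunc F) V.num :=
    (div_eq_iff hd).1 (RatFunc.num_div_denom V) |>.symm
  -- The target is only a ring, but images of nonzero denominators are units and can be cancelled.
  have hu : IsUnit (g (algebraMap (Polynomial F) (RatFunc F) V.denom)) :=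
    (IsUnit.mk0 _ hd).map g
  apply hu.mul_right_cancel
  rw [← map_mul, hV, ← h', ← h', ← map_mul, hV]

/-- Compatibility of `γ` with the change of variables on the centre; it need only be checked on `F`
and at `Y`, where both sides are `W(z + T)`. -/
theorem taylorCan_map_ofFracCentre (hz : z ≠ 0)
    (hγK : ∀ a : K, γ (ofSkew θ (ofK θ a)) = ofSkew θ (ofK θ a))
    (hγX : γ (ofSkew θ (X θ)) * ofSkew θ ↑(X θ)⁻¹ = ofFracCentre θ C)
    (hW : W = C ^ orderOf θ * RatFunc.X) (h : IsRegularAt θ W z)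
    (hd : valueAt θ (ratDeriv W) z ≠ 0) (V : FracCentre θ) :
    taylorCan hp hz (γ (ofFracCentre θ V)) = serT θ z (changeVar h hd (taylorRat θ _ V)) := by
  have : ((taylorCan hp hz).comp (γ.comp (ofFracCentre θ)) : FracCentre θ →+* Target θ z) =
      (serT θ z).comp ((changeVar h hd).comp (taylorRat θ _)) := by
    refine ratFunc_ringHom_ext ?_ ?_
    · intro a
      have h1 : ofFracCentre θ (RatFunc.C a) = ofSkew θ (ofK θ (a : K)) := by
        rw [← RatFunc.algebraMap_C, ← ofSkew_toLaurent, Polynomial.toLaurent_C]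
        congr 1
        exact (centreHom_single θ 0 a).trans (by rw [mul_zero]; rfl)
      simp only [RingHom.comp_apply]
      rw [h1, hγK, ← h1, taylorCan_ofFracCentre, taylorRat_C, taylorRat_C, changeVar_C,
        resMap_algebraMap]
    · simp only [RingHom.comp_apply]
      rw [changeVar_taylorRat_X, ← ofSkew_X_pow_order, map_X_pow_order hγX, ← hW,
        taylorCan_ofFracCentre]
  exact congrArg (fun f => f V) this

theorem sresCan_mul_mono (hz : z ≠ 0) (V : FracCentre θ) (a : K) (n : ℤ) :
    sresCan hp hz (ofFracCentre θ V * ofSkew θ (mono θ a n)) =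
      resHom θ z ((taylorRat θ z V *
        HahnSeries.ofPowerSeries ℤ _ (canSeries hp z) ^ n).coeff (-1)) *
          red θ z (mono θ a n) := by
  rw [sresCan, map_mul, taylorCan_ofFracCentre, taylorCan_ofSkew, taylorSkew_mono_eq, ← mul_assoc,
    ← map_mul, coeff_serT_mul_constT]

/-- The core computation. The factor `C(z)^n` produced by reducing `X^n` matches the discrepancy
between the two root series, and `coeff_changeVar` handles the rest. -/
theorem redMap_sresCan_mul_mono (hz : z ≠ 0)
    (hγK : ∀ a : K, γ (ofSkew θ (ofK θ a)) = ofSkew θ (ofK θ a))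
    (hγX : γ (ofSkew θ (X θ)) * ofSkew θ ↑(X θ)⁻¹ = ofFracCentre θ C)
    (hW : W = C ^ orderOf θ * RatFunc.X) (hC : IsRegularAt θ C z) (h : IsRegularAt θ W z)
    (hd : valueAt θ (ratDeriv W) z ≠ 0) (V : FracCentre θ) (a : K) (n : ℤ) :
    redMap hW hC h (sresCan hp h.valueAt_ne_zero
        (ofFracCentre θ V * ofSkew θ (mono θ a n))) =
      sresCan hp hz (γ (ofFracCentre θ V * ofSkew θ (mono θ a n)) *
        ofFracCentre θ (ratDeriv W)) := by
  have hC0 : C ≠ 0 := by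
    rintro rfl
    exact hC.1 (by simp)
  have hκ : HahnSeries.C (constantCoeff (taylorReg θ z C)) *
      changeVar h hd (HahnSeries.ofPowerSeries ℤ _ (canSeries hp (valueAt θ W z))) =
      taylorRat θ z C * HahnSeries.ofPowerSeries ℤ _ (canSeries hp z) := by
    rw [changeVar, substLaurent_ofPowerSeries, ← ofPowerSeries_taylorReg hC, ← map_mul,
      ← substHom_canSeries hp hz hW hC h, map_mul, HahnSeries.ofPowerSeries_C]
  -- By `hκ`, the factor `(C(z + T) (1 + T/z)^{1/r})^n` is the constant `C(z)^n` times the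
  -- substituted `n`-th power of the root at `W(z)`. This brings the series into the shape `s(u)
  -- u'`.
  have hR : taylorCan hp hz (γ (ofFracCentre θ V * ofSkew θ (mono θ a n)) *
      ofFracCentre θ (ratDeriv W)) =
      serT θ z (HahnSeries.C (constantCoeff (taylorReg θ z C) ^ n) *
        (changeVar h hd (taylorRat θ _ V *
          HahnSeries.ofPowerSeries ℤ _ (canSeries hp (valueAt θ W z)) ^ n) *
          taylorRat θ z (ratDeriv W))) * constT θ z (red θ z (mono θ a n)) := by
    rw [← (ofFracCentre_commute _ _).eq, map_mul, map_mul γ, map_mul (taylorCan hp hz),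
      taylorCan_map_ofFracCentre hp hz hγK hγX hW h hd, map_mono_eq hγK hγX hC0, map_mul,
      taylorCan_ofFracCentre, taylorCan_ofFracCentre, taylorCan_ofSkew, taylorSkew_mono_eq,
      ← mul_assoc, ← mul_assoc, ← mul_assoc, ← map_mul, ← map_mul, ← map_mul]
    congr 2
    rw [map_zpow₀, mul_assoc _ _ (_ ^ n), ← mul_zpow, ← hκ, mul_zpow,
      map_mul, map_zpow₀, map_zpow₀]
    ring
  have hL : redMap hW hC h (red θ _ (mono θ a n)) =
      resHom θ z (constantCoeff (taylorReg θ z C) ^ n) * red θ z (mono θ a n) := by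
    rw [redMap_red, twistSkew_mono]
    rfl
  rw [sresCan_mul_mono, map_mul, redMap_resHom, hL, ← coeff_changeVar h hd, sresCan, hR,
    coeff_serT_mul_constT, HahnSeries.C_apply, HahnSeries.coeff_single_zero_mul, map_mul,
    ← mul_assoc, ← map_mul, ← map_mul, mul_comm (HahnSeries.coeff _ _)]

theorem redMap_sresCan (hz : z ≠ 0)
    (hγK : ∀ a : K, γ (ofSkew θ (ofK θ a)) = ofSkew θ (ofK θ a))
    (hγX : γ (ofSkew θ (X θ)) * ofSkew θ ↑(X θ)⁻¹ = ofFracCentre θ C)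
    (hW : W = C ^ orderOf θ * RatFunc.X) (hC : IsRegularAt θ C z) (h : IsRegularAt θ W z)
    (hd : valueAt θ (ratDeriv W) z ≠ 0) (f : FracSkew θ) :
    redMap hW hC h (sresCan hp h.valueAt_ne_zero f) =
      sresCan hp hz (γ f * ofFracCentre θ (ratDeriv W)) := by
  have hzero {z : Fs} (hz : z ≠ 0) : sresCan hp hz (0 : FracSkew θ) = 0 := by
    rw [sresCan, map_zero]; rfl
  have hadd {z : Fs} (hz : z ≠ 0) (f g : FracSkew θ) :
      sresCan hp hz (f + g) = sresCan hp hz f + sresCan hp hz g := by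
    rw [sresCan, map_add]; rfl
  induction f using TensorProduct.induction_on with
  | zero => rw [hzero, map_zero, map_zero, zero_mul, hzero]
  | add f g hf hg => rw [hadd, map_add, map_add, add_mul, hadd, hf, hg]
  | tmul V x =>
    rw [tmul_eq]
    refine skew_induction θ (P := fun x => redMap hW hC h (sresCan hp h.valueAt_ne_zero
      (ofFracCentre θ V * ofSkew θ x)) =
        sresCan hp hz (γ (ofFracCentre θ V * ofSkew θ x) * ofFracCentre θ (ratDeriv W)))
      ?_ ?_ ?_ x
    · rw [map_zero, mul_zero, hzero, map_zero, map_zero, zero_mul, hzero]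
    · exact redMap_sresCan_mul_mono hp hz hγK hγX hW hC h hd V
    · intro x y hx hy
      rw [map_add, mul_add, hadd, map_add, map_add, add_mul, hadd, hx, hy]

end Skew

end SkewRes

end

/-! ### Assembly: the induced morphism, its uniqueness and the residue formula -/

theorem mainTheorem5 {K : Type*} [Field K] (θ : RingAut K) (hθ : IsOfFinOrder θ)
    (hp : ¬ ringChar K ∣ orderOf θ)
    {Fs : Type*} [Field Fs] [Algebra (SkewRes.FixedField θ) Fs]
    [IsSepClosure (SkewRes.FixedField θ) Fs]
    (γ : SkewRes.FracSkew θ →+* SkewRes.FracSkew θ)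
    (hγK : ∀ a : K, γ (SkewRes.ofSkew θ (SkewRes.ofK θ a)) = SkewRes.ofSkew θ (SkewRes.ofK θ a))
    (hγX : ∃ C : SkewRes.FracCentre θ,
      γ (SkewRes.ofSkew θ (SkewRes.X θ)) * SkewRes.ofSkew θ ↑(SkewRes.X θ)⁻¹ =
        SkewRes.ofFracCentre θ C) :
    ∃ W : SkewRes.FracCentre θ,
      γ (SkewRes.ofSkew θ (SkewRes.X θ ^ orderOf θ : (SkewRes.Skew θ)ˣ)) =
        SkewRes.ofFracCentre θ W ∧
      ∀ (z : Fs) (hz : z ≠ 0) (hreg : SkewRes.IsRegularAt θ W z),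
        SkewRes.valueAt θ (SkewRes.ratDeriv W) z ≠ 0 →
        ∃ g : SkewRes.QuotSkew θ (SkewRes.valueAt θ W z) →+* SkewRes.QuotSkew θ z,
          SkewRes.IsInducedBy θ γ g ∧
          (∀ g', SkewRes.IsInducedBy θ γ g' → g' = g) ∧
          ∀ f : SkewRes.FracSkew θ,
            g (SkewRes.sresCan hp hreg.valueAt_ne_zero f) =
              SkewRes.sresCan hp hz (γ f * SkewRes.ofFracCentre θ (SkewRes.ratDeriv W)) := by
  obtain ⟨C, hγX⟩ := hγX
  refine ⟨C ^ orderOf θ * RatFunc.X, SkewRes.map_X_pow_order hγX, fun z hz hreg hd => ?_⟩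
  have hC := SkewRes.IsRegularAt.of_pow_mul_X (SkewRes.orderOf_ne_zero_of_not_dvd hp) hz hreg
  have hind := SkewRes.isInducedBy_redMap hγK hγX rfl hC hreg
  refine ⟨SkewRes.redMap rfl hC hreg, hind, fun g' hg' => ?_,
    SkewRes.redMap_sresCan hp hz hγK hγX rfl hC hreg hd⟩
  -- A morphism out of the quotient is determined on classes of elements of `A`, and there by
  -- uniqueness of reductions.
  apply Ideal.Quotient.ringHom_ext
  ext x
  exact (hg' x).unique hp hz (hind x)
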